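/- Let $\langle x,y\rangle=x_1y_1+\dots+x_{n+1}y_{n+1}-x_{n+2}y_{n+2}$ and let $\mathcal M^n=\{[x]\in\mathbb{R}\mathrm{P}^{n+1}\mid\langle x,x\rangle=0\}$ be the Möbius quadric, with $n\in\{2,3\}$. A circle in $\mathcal M^n$ is the intersection of $\mathcal M^n$ with a $2$-dimensional projective subspace (a plane). An $(n-1)$-dimensional Darboux cyclide $\mathcal D$ in $\mathcal M^n$ is the intersection of $\mathcal M^n$ with a real quadric hypersurface $\mathcal Q\neq\mathcal M^n$ (given by a non-zero symmetric form, up to scale); for $n=2$ it is called a cyclic, and its imaginary points are the points of the intersection of the complexified quadrics. Let $M:\mathbb Z^2\to\mathcal M^n$ be a circular net: for all $(i,j)$ the points $M_{i,j},M_{i+1,j},M_{i+1,j+1},M_{i,j+1}$ lie on a circle. Suppose that, for every $i$, the points $\{M_{i,j}\}_{j\in\mathbb Z}$ lie on a circle $\mathcal V_i=V_i\cap\mathcal M^n$ and, for every $j$, the points $\{M_{i,j}\}_{i\in\mathbb Z}$ lie on a circle $\mathcal H_j=H_j\cap\mathcal M^n$, where $V_i$ and $H_j$ are planes. Assume the following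 non-degeneracy: the four vertices of each quad $M_{i,j},M_{i+1,j},M_{i+1,j+1},M_{i,j+1}$ are distinct, and so are any three consecutive vertices $M_{i,j},M_{i+1,j},M_{i+2,j}$ or $M_{i,j},M_{i,j+1},M_{i,j+2}$ of a parameter line. (i) Let $n=3$ and suppose that $V_i\ne V_{i+1}$ and $H_j\neq H_{j+1}$ for all $i,j$. Then there is a $2$-dimensional Darboux cyclide $\mathcal D$ in $\mathcal M^3$ that contains all the circles $\mathcal V_i$ and $\mathcal H_j$. (ii) Let $n=2$ and suppose that the net is generic in the following sense: no three of the planes $V_i$ and no three of the planes $H_j$ have a common line; the circles $\mathcal V_i$ do not all pass through one point, and neither do the circles $\mathcal H_j$; for all $i,j$ the three lines $M_{k,j}\vee M_{k,j+1}$, $k=i,i+1,i+2$, are not concurrent and the three lines $M_{i,l}\vee M_{i+1,l}$, $l=j,j+1,j+2$, are not concurrent. Then there is a cyclic $\mathcal D=\mathcal Q\cap\mathcal M^2$ such that: - the circles $\{\mathcal V_i\}_{i\in\mathbb Z}$ envelop $\mathcal D$, and so do the circles $\{\mathcal H_j\}_{j\in\mathbb Z}$: for each of the two families there is a quadratic cone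 $\mathcal K$ (a quadric of rank $3$) in the pencil spanned by $\mathcal Q$ and $\mathcal M^2$, with $\mathcal K\cap\mathcal M^2=\mathcal D$, such that the planes of all the circles of the family are tangent planes of $\mathcal K$; - each circle $\mathcal V_i$ and each circle $\mathcal H_j$ is twice tangent to $\mathcal D$: it has exactly two (possibly imaginary) points in common with $\mathcal D$, and at these points $\mathcal D$ is smooth and has the same tangent line as the circle. Here the two points are counted with multiplicity: they may coincide in one point of contact of order four (that is, some combination of the forms of $\mathcal Q$ and $\mathcal M^2$ with non-zero coefficient at $\mathcal Q$ restricts on the plane of the circle to the square of a linear form that defines the tangent line of the circle at that point), but this happens for at most four of the circles $\mathcal V_i$ and for at most four of the circles $\mathcal H_j$. -/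

import Mathlib

open scoped LinearAlgebra.Projectivization

namespace CircularNets

/-- Homogeneous coordinate vectors `(x_1, …, x_{n+2})` of the real projective space of
dimension `n + 1`. -/
abbrev Vec (n : ℕ) : Type := Fin (n + 2) → ℝ

/-- Complex homogeneous coordinate vectors. -/
abbrev CVec (n : ℕ) : Type := Fin (n + 2) → ℂ

/-- The real projective space of dimension `n + 1`. -/
abbrev RP (n : ℕ) : Type := ℙ ℝ (Vec n)

/-- Gram matrices of bilinear forms on `Vec n`. -/
abbrev Form (n : ℕ) : Type := Matrix (Fin (n + 2)) (Fin (n + 2)) ℝ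

/-- The matrix of the Lorentz product `x_1 y_1 + … + x_{n+1} y_{n+1} - x_{n+2} y_{n+2}`. -/
def lorentz (n : ℕ) : Form n :=
  Matrix.diagonal fun k => if k = Fin.last (n + 1) then -1 else 1

/-- The value `xᵀ A y` of the bilinear form with matrix `A`. -/
def bil {n : ℕ} (A : Form n) (x y : Vec n) : ℝ :=
  dotProduct x (A.mulVec y)

/-- The complexified covector `A p`, for a complex vector `p`. -/
noncomputable def cpolar {n : ℕ} (A : Form n) (p : CVec n) : CVec n :=
  (A.map (fun r : ℝ => (r : ℂ))).mulVec p

/-- The complex bilinear extension of `bil A`. -/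
noncomputable def cbil {n : ℕ} (A : Form n) (x y : CVec n) : ℂ :=
  dotProduct x (cpolar A y)

/-- The complexification of a real linear subspace. -/
noncomputable def complexify {n : ℕ} (W : Submodule ℝ (Vec n)) : Submodule ℂ (CVec n) :=
  Submodule.span ℂ ((fun (v : Vec n) (k : Fin (n + 2)) => ((v k : ℝ) : ℂ)) '' (W : Set (Vec n)))

/-- The real points of the quadric with matrix `A`. -/
def zeroLocus {n : ℕ} (A : Form n) : Set (RP n) :=
  {p | ∀ x ∈ p.submodule, bil A x x = 0}

/-- The Möbius quadric of dimension `n`. -/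
def moebiusQuadric (n : ℕ) : Set (RP n) := zeroLocus (lorentz n)

/-- The points of the Möbius quadric in the projective subspace given by `W`. For
`finrank W = 3` this is the circle cut out by a projective plane. -/
def sphere {n : ℕ} (W : Submodule ℝ (Vec n)) : Set (RP n) :=
  {p | p ∈ moebiusQuadric n ∧ p.submodule ≤ W}

/-- A circular net in the Möbius quadric of dimension `n`: the four vertices of each elementary
quadrilateral lie on a circle. The four vertices are distinct, and so are any three consecutive
vertices of a parameter line. -/
structure IsCircularNet {n : ℕ} (M : ℤ → ℤ → RP n) : Prop where
  mem : ∀ i j, M i j ∈ moebiusQuadric n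
  quad : ∀ i j, ∃ W : Submodule ℝ (Vec n), Module.finrank ℝ W = 3 ∧
    M i j ∈ sphere W ∧ M (i + 1) j ∈ sphere W ∧
    M (i + 1) (j + 1) ∈ sphere W ∧ M i (j + 1) ∈ sphere W
  ne_fst : ∀ i j, M i j ≠ M (i + 1) j
  ne_snd : ∀ i j, M i j ≠ M i (j + 1)
  ne_diag : ∀ i j, M i j ≠ M (i + 1) (j + 1)
  ne_antidiag : ∀ i j, M (i + 1) j ≠ M i (j + 1)
  ne_fst_two : ∀ i j, M i j ≠ M (i + 2) j
  ne_snd_two : ∀ i j, M i j ≠ M i (j + 2)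

/-- Both families of parameter lines are circular: the vertices `M i j`, `j ∈ ℤ`, lie on the circle
cut out by the plane `V i`, and the vertices `M i j`, `i ∈ ℤ`, on the circle cut out by the
plane `H j`. -/
structure HasCircularLines {n : ℕ} (M : ℤ → ℤ → RP n) (V H : ℤ → Submodule ℝ (Vec n)) : Prop where
  finrank_V : ∀ i, Module.finrank ℝ (V i) = 3
  finrank_H : ∀ j, Module.finrank ℝ (H j) = 3
  mem_V : ∀ i j, M i j ∈ sphere (V i)
  mem_H : ∀ i j, M i j ∈ sphere (H j)

/-- General position of a family of planes and of the circles cut out by them: no three of the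
planes have a common line (no three of the circles are coaxial), and the circles do not all pass
through one point. -/
structure GeneralPosition {n : ℕ} (W : ℤ → Submodule ℝ (Vec n)) : Prop where
  not_coaxial : ∀ i k l, i ≠ k → k ≠ l → i ≠ l →
    Module.finrank ℝ (W i ⊓ W k ⊓ W l : Submodule ℝ (Vec n)) ≤ 1
  no_common_point : ¬ ∃ p : RP n, ∀ i, p ∈ sphere (W i)

/-- Three successive transversal edges of a strip of the net never lie on concurrent lines. -/
structure EdgesNotConcurrent {n : ℕ} (M : ℤ → ℤ → RP n) : Prop where
  fst : ∀ i j,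
    ((M i j).submodule ⊔ (M i (j + 1)).submodule) ⊓
    ((M (i + 1) j).submodule ⊔ (M (i + 1) (j + 1)).submodule) ⊓
    ((M (i + 2) j).submodule ⊔ (M (i + 2) (j + 1)).submodule) = ⊥
  snd : ∀ i j,
    ((M i j).submodule ⊔ (M (i + 1) j).submodule) ⊓
    ((M i (j + 1)).submodule ⊔ (M (i + 1) (j + 1)).submodule) ⊓
    ((M i (j + 2)).submodule ⊔ (M (i + 1) (j + 2)).submodule) = ⊥

/-- An `(n - 1)`-dimensional Darboux cyclide in the Möbius quadric: its intersection with a real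
quadric other than the Möbius quadric itself. For `n = 2` this is a cyclic. (The choice `c = 0` in
`ne_lorentz` says that the form is not zero.) -/
structure DarbouxCyclide (n : ℕ) where
  form : Form n
  symm : form.IsSymm
  ne_lorentz : ∀ c : ℝ, form ≠ c • lorentz n

namespace DarbouxCyclide

/-- The real points of a Darboux cyclide. -/
def points {n : ℕ} (D : DarbouxCyclide n) : Set (RP n) :=
  moebiusQuadric n ∩ zeroLocus D.form

/-- `p` is a non-zero vector that represents a real or imaginary point of the cyclide. -/
def IsPoint {n : ℕ} (D : DarbouxCyclide n) (p : CVec n) : Prop :=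
  p ≠ 0 ∧ cbil (lorentz n) p p = 0 ∧ cbil D.form p p = 0

/-- The circle cut out by the plane `W` is tangent to the cyclic `D` at the (real or imaginary)
point `p`: `p` is a common point, `D` is smooth at `p` (the tangent planes at `p` of the two
quadrics that cut out `D` are distinct), and the tangent line of `D` at `p`, i.e. the intersection
of those two tangent planes, is the tangent line of the circle at `p`. -/
def TangentAt (D : DarbouxCyclide 2) (W : Submodule ℝ (Vec 2)) (p : CVec 2) : Prop :=
  D.IsPoint p ∧ p ∈ complexify W ∧
  LinearIndependent ℂ ![cpolar (lorentz 2) p, cpolar D.form p] ∧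
  ∀ w : CVec 2, (cbil (lorentz 2) w p = 0 ∧ cbil D.form w p = 0) ↔
    (w ∈ complexify W ∧ cbil (lorentz 2) w p = 0)

/-- The circle cut out by `W` is tangent to `D` at exactly two distinct (real or imaginary)
points, and has no other point in common with `D`. -/
def TangentAtTwoPoints (D : DarbouxCyclide 2) (W : Submodule ℝ (Vec 2)) : Prop :=
  ∃ p q : CVec 2, LinearIndependent ℂ ![p, q] ∧ D.TangentAt W p ∧ D.TangentAt W q ∧
    ∀ r : CVec 2, r ∈ complexify W → D.IsPoint r →
      r ∈ Submodule.span ℂ {p} ∨ r ∈ Submodule.span ℂ {q}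

/-- The circle cut out by `W` is tangent to `D` at a point `p` with contact of order four: in the
plane `W`, the pencil of the two conics contains the double tangent line at `p`. This is the
case of two coinciding tangency points. -/
def TangentAtDoublePoint (D : DarbouxCyclide 2) (W : Submodule ℝ (Vec 2)) : Prop :=
  ∃ p : CVec 2, D.TangentAt W p ∧ ∃ s t : ℂ, t ≠ 0 ∧ ∀ w ∈ complexify W,
    cbil D.form w w = s * cbil (lorentz 2) w w + t * cbil (lorentz 2) w p ^ 2

/-- The circle cut out by `W` is twice tangent to `D`; the two tangency points are counted with
multiplicity. -/
def TwiceTangent (D : DarbouxCyclide 2) (W : Submodule ℝ (Vec 2)) : Prop :=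
  D.TangentAtTwoPoints W ∨ D.TangentAtDoublePoint W

end DarbouxCyclide

/-- `W` is the tangent plane of the quadric `K` at a regular point `p` of `K`. -/
def IsTangentPlane (K : Form 2) (W : Submodule ℝ (Vec 2)) : Prop :=
  ∃ p : Vec 2, K.mulVec p ≠ 0 ∧ bil K p p = 0 ∧ ∀ w : Vec 2, w ∈ W ↔ bil K w p = 0

/-- The circles cut out by the planes `W i` envelop the cyclic `D`: they belong to one of the
one-parameter families of circles of which `D` is the envelope. Such a family consists of the
circles cut out by the tangent planes of a quadratic cone `K` that, together with the Möbius
quadric, cuts out `D`; i.e. `K` is a quadric of rank three, other than the Möbius quadric, in the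
pencil spanned by the Möbius quadric and the quadric of `D`. -/
def Envelop (W : ℤ → Submodule ℝ (Vec 2)) (D : DarbouxCyclide 2) : Prop :=
  ∃ a b : ℝ, b ≠ 0 ∧ (a • lorentz 2 + b • D.form).rank = 3 ∧
    ∀ i, IsTangentPlane (a • lorentz 2 + b • D.form) (W i)

end CircularNets

/-!
Represent the vertices of the net by null vectors. If `n ≥ 3`, then the symmetric forms on the
ambient space have dimension at least fifteen, and fourteen linear conditions leave a nonzero form
`A` that vanishes on `H 0`, is a multiple `c` of the Lorentz product on `V 0`, and vanishes at nine
vertices. The relation between the vertices of a quadrilateral says that the line through two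
vertices of a circle meets the plane of the next circle. Hence the vanishing of `A` propagates from
each `H j` to its neighbours, and that of `A - c • lorentz n` from each `V i` to its neighbours.

If `n = 2`, then each plane has a unit normal vector, `v i` or `h j`. Two successive transversal
edges of the strip between `H j` and `H (j + 1)` are exchanged by a reflection that fixes `h j` and
`h (j + 1)`, so the angle under which the projections of these two normals along an edge appear is
the same for all edges of the strip. It determines a quadric in the pencil spanned by the Möbius
quadric and the pair of planes `H j`, `H (j + 1)` that is tangent to all planes `V i`. Comparing two
successive strips, one finds a point `k` that lies on all planes `V i`; the cone with apex `k` that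
touches the quadric along a conic is then tangent to all `V i`. This cone does not depend on the
strip, and its difference with the Lorentz form is a cone that is tangent to all `H j`.
-/

namespace CircularNets

section LinearAlgebra

variable {𝕜 E : Type*} [Field 𝕜] [AddCommGroup E] [Module 𝕜 E]

theorem linearIndependent_triple_iff {x y z : E} : LinearIndependent 𝕜 ![x, y, z] ↔
    ∀ a b c : 𝕜, a • x + b • y + c • z = 0 → a = 0 ∧ b = 0 ∧ c = 0 := by
  simp only [Fintype.linearIndependent_iff, Fin.sum_univ_three, Fin.forall_fin_succ_pi,
    Fin.forall_fin_zero_pi, Fin.forall_fin_succ, IsEmpty.forall_iff, and_true]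
  rfl

theorem span_triple_eq_of_finrank_eq_three {W : Submodule 𝕜 E} (hW : Module.finrank 𝕜 W = 3)
    {x y z : E} (h : LinearIndependent 𝕜 ![x, y, z]) (hx : x ∈ W) (hy : y ∈ W) (hz : z ∈ W) :
    Submodule.span 𝕜 {x, y, z} = W := by
  have : FiniteDimensional 𝕜 W := Module.finite_of_finrank_pos (by omega)
  have range_triple : Set.range ![x, y, z] = {x, y, z} := by
    simp only [Matrix.range_cons, Matrix.range_empty, Set.union_empty, Set.singleton_union]
  refine Submodule.eq_of_le_of_finrank_eq ?_ ?_
  · simp [Submodule.span_le, Set.insert_subset_iff, hx, hy, hz]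
  · rw [hW, ← range_triple, finrank_span_eq_card h, Fintype.card_fin]

theorem exists_coeff_of_mem {W : Submodule 𝕜 E} (hW : Module.finrank 𝕜 W = 3)
    {x y z w : E} (h : LinearIndependent 𝕜 ![x, y, z]) (hx : x ∈ W) (hy : y ∈ W) (hz : z ∈ W)
    (hw : w ∈ W) : ∃ a b c : 𝕜, a • x + b • y + c • z = w := by
  rwa [← span_triple_eq_of_finrank_eq_three hW h hx hy hz, Submodule.mem_span_triple] at hw

/-- The vectors of a family lie in general linear position: any three of them are linearly
independent. -/
def InGeneralPosition (𝕜 : Type*) {ι E : Type*} [Field 𝕜] [AddCommGroup E] [Module 𝕜 E]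
    (p : ι → E) : Prop :=
  ∀ i j k, i ≠ j → j ≠ k → i ≠ k → LinearIndependent 𝕜 ![p i, p j, p k]

theorem InGeneralPosition.comp {ι κ : Type*} {p : ι → E} (hp : InGeneralPosition 𝕜 p) {f : κ → ι}
    (hf : Function.Injective f) : InGeneralPosition 𝕜 (p ∘ f) :=
  fun _ _ _ hij hjk hik => hp _ _ _ (hf.ne hij) (hf.ne hjk) (hf.ne hik)

theorem InGeneralPosition.ne_smul {ι : Type*} [Infinite ι] {p : ι → E}
    (hp : InGeneralPosition 𝕜 p) {i j : ι} (hij : i ≠ j) (c : 𝕜) : p i ≠ c • p j := by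
  classical
  intro e
  obtain ⟨k, hk⟩ := Infinite.exists_notMem_finset ({i, j} : Finset ι)
  simp only [Finset.mem_insert, Finset.mem_singleton, not_or] at hk
  have relation : (1 : 𝕜) • p i + (-c) • p j + (0 : 𝕜) • p k = 0 := by rw [e]; module
  exact one_ne_zero (linearIndependent_triple_iff.mp (hp i j k hij (Ne.symm hk.2) (Ne.symm hk.1))
    _ _ _ relation).1

theorem exists_symm_of_card_lt {ι κ : Type*} [Fintype ι] [Fintype κ]
    (f : κ → Matrix ι ι 𝕜 →ₗ[𝕜] 𝕜)
    (h : Fintype.card κ < (Fintype.card ι + 1).choose 2) :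
    ∃ A : Matrix ι ι 𝕜, A ≠ 0 ∧ A.IsSymm ∧ ∀ k, f k A = 0 := by
  classical
  let symm : (Sym2 ι → 𝕜) →ₗ[𝕜] Matrix ι ι 𝕜 :=
    { toFun g := Matrix.of fun i j => g s(i, j)
      map_add' _ _ := rfl
      map_smul' _ _ := rfl }
  have hlt : Module.finrank 𝕜 (κ → 𝕜) < Module.finrank 𝕜 (Sym2 ι → 𝕜) := by
    rwa [Module.finrank_fintype_fun_eq_card, Module.finrank_fintype_fun_eq_card, Sym2.card]
  obtain ⟨g, hg, hg0⟩ := (Submodule.ne_bot_iff _).mp <|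
    LinearMap.ker_ne_bot_of_finrank_lt (f := LinearMap.pi fun k => f k ∘ₗ symm) hlt
  refine ⟨symm g, fun h0 => hg0 (funext fun p => ?_),
    Matrix.IsSymm.ext fun i j => congrArg g Sym2.eq_swap,
    fun k => congrFun (LinearMap.mem_ker.mp hg) k⟩
  induction p with
  | h i j => exact congrFun₂ h0 i j

end LinearAlgebra

section IsotropicVectors

variable {𝕜 E : Type*} [Field 𝕜] [AddCommGroup E] [Module 𝕜 E] {F : LinearMap.BilinForm 𝕜 E}
  {W : Submodule 𝕜 E} {x y z : E}

theorem coeff_eq_zero_of_orthogonal_isotropic_triple (h2 : (2 : 𝕜) ≠ 0) (hF : F.IsSymm)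
    (hx : F x x = 0) (hy : F y y = 0) (hz : F z z = 0) (hxy : F x y ≠ 0) (hxz : F x z ≠ 0)
    (hyz : F y z ≠ 0) {a b c : 𝕜} (ex : F (a • x + b • y + c • z) x = 0)
    (ey : F (a • x + b • y + c • z) y = 0) (ez : F (a • x + b • y + c • z) z = 0) :
    a = 0 ∧ b = 0 ∧ c = 0 := by
  simp only [map_add, map_smul, LinearMap.add_apply, LinearMap.smul_apply, smul_eq_mul, hx, hy, hz,
    hF.eq y x, hF.eq z x, hF.eq z y, mul_zero, zero_add, add_zero] at ex ey ez
  have hc : c = 0 := by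
    have : 2 * F x z * F y z * c = 0 := by
      linear_combination F y z * ex + F x z * ey - F x y * ez
    simpa [h2, hxz, hyz] using this
  subst hc
  exact ⟨by simpa [hxy] using ey, by simpa [hxy] using ex, rfl⟩

theorem linearIndependent_of_isotropic_triple (h2 : (2 : 𝕜) ≠ 0) (hF : F.IsSymm)
    (hx : F x x = 0) (hy : F y y = 0) (hz : F z z = 0) (hxy : F x y ≠ 0) (hxz : F x z ≠ 0)
    (hyz : F y z ≠ 0) : LinearIndependent 𝕜 ![x, y, z] := by
  rw [linearIndependent_triple_iff]
  intro a b c h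
  exact coeff_eq_zero_of_orthogonal_isotropic_triple h2 hF hx hy hz hxy hxz hyz
    (by simp [h]) (by simp [h]) (by simp [h])

theorem exists_relation_of_isotropic_quadruple (h2 : (2 : 𝕜) ≠ 0) (hF : F.IsSymm)
    (hW : Module.finrank 𝕜 W = 3) {p : Fin 4 → E} (hpW : ∀ i, p i ∈ W)
    (hp : ∀ i, F (p i) (p i) = 0) (hpp : ∀ i j, i ≠ j → F (p i) (p j) ≠ 0) :
    ∃ a : Fin 4 → 𝕜, (∀ i, a i ≠ 0) ∧ ∑ i, a i • p i = 0 := by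
  have : FiniteDimensional 𝕜 W := Module.finite_of_finrank_pos (by omega)
  have dependent : ¬ LinearIndependent 𝕜 p := fun h => by
    have := (LinearIndependent.of_comp W.subtype
      (v := fun i => (⟨p i, hpW i⟩ : W)) h).fintype_card_le_finrank
    simp [hW] at this
  obtain ⟨a, ha, i, hi⟩ := Fintype.not_linearIndependent_iff.mp dependent
  refine ⟨a, fun j hj => hi ?_, ha⟩
  have independent : LinearIndependent 𝕜 fun k => p (j.succAbove k) := by
    have key := linearIndependent_of_isotropic_triple h2 hF (hp (j.succAbove 0))
      (hp (j.succAbove 1)) (hp (j.succAbove 2)) (hpp _ _ <| by simp) (hpp _ _ <| by simp)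
      (hpp _ _ <| by simp)
    convert key using 1
    ext k
    fin_cases k <;> rfl
  rw [Fin.sum_univ_succAbove _ j, hj, zero_smul, zero_add] at ha
  rcases Fin.eq_self_or_eq_succAbove j i with rfl | ⟨k, rfl⟩
  · exact hj
  · exact Fintype.linearIndependent_iff.mp independent _ ha k

/-- A subspace on which a bilinear form vanishes identically: a projective subspace contained in
the quadric of a symmetric form. -/
def IsTotallyIsotropic (F : LinearMap.BilinForm 𝕜 E) (W : Submodule 𝕜 E) : Prop :=
  ∀ x ∈ W, ∀ y ∈ W, F x y = 0

theorem isTotallyIsotropic_span_triple (hF : F.IsSymm) (hx : F x x = 0) (hy : F y y = 0)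
    (hz : F z z = 0) (hxy : F x y = 0) (hxz : F x z = 0) (hyz : F y z = 0) :
    IsTotallyIsotropic F (Submodule.span 𝕜 {x, y, z}) := by
  intro u hu v hv
  obtain ⟨a, b, c, rfl⟩ := Submodule.mem_span_triple.mp hu
  obtain ⟨a', b', c', rfl⟩ := Submodule.mem_span_triple.mp hv
  simp [hx, hy, hz, hxy, hxz, hyz, hF.eq y x, hF.eq z x, hF.eq z y]

/-- Two sides of the triangle `x`, `y`, `z` meet the plane `W`. Evaluating the form at these two
points shows that the vertices are pairwise conjugate. -/
theorem IsTotallyIsotropic.span_triple (h2 : (2 : 𝕜) ≠ 0) (hF : F.IsSymm)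
    (hW : IsTotallyIsotropic F W) (hx : F x x = 0) (hy : F y y = 0) (hz : F z z = 0)
    {a b c d : 𝕜} (ha : a ≠ 0) (hb : b ≠ 0) (hc : c ≠ 0) (hd : d ≠ 0)
    (hxy : a • x + b • y ∈ W) (hyz : c • y + d • z ∈ W) :
    IsTotallyIsotropic F (Submodule.span 𝕜 {x, y, z}) := by
  have exy := hW _ hxy _ hxy
  have eyz := hW _ hyz _ hyz
  have exz := hW _ hxy _ hyz
  simp only [map_add, map_smul, LinearMap.add_apply, LinearMap.smul_apply, smul_eq_mul, hx, hy, hz,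
    hF.eq y x, hF.eq z y, mul_zero, zero_add, add_zero] at exy eyz exz
  have fxy : F x y = 0 := by
    have : 2 * a * b * F x y = 0 := by linear_combination exy
    simpa [h2, ha, hb] using this
  have fyz : F y z = 0 := by
    have : 2 * c * d * F y z = 0 := by linear_combination eyz
    simpa [h2, hc, hd] using this
  have fxz : F x z = 0 := by simpa [fxy, fyz, ha, hd] using exz
  exact isTotallyIsotropic_span_triple hF hx hy hz fxy fxz fyz

end IsotropicVectors

/-- The Lorentz product as a bilinear form. -/
noncomputable def lorentzForm (n : ℕ) : LinearMap.BilinForm ℝ (Vec n) :=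
  (lorentz n).toBilin'

local notation "⟪" x "," y "⟫" => lorentzForm _ x y

section LorentzForm

variable {n : ℕ}

theorem bil_eq_toBilin' (A : Form n) (x y : Vec n) : bil A x y = A.toBilin' x y :=
  (Matrix.toBilin'_apply' A x y).symm

theorem bil_lorentz (x y : Vec n) : bil (lorentz n) x y = ⟪x, y⟫ :=
  bil_eq_toBilin' _ x y

theorem lorentzForm_apply (x y : Vec n) : ⟪x, y⟫ =
    ∑ k : Fin (n + 1), x k.castSucc * y k.castSucc - x (Fin.last _) * y (Fin.last _) := by
  simp [← bil_lorentz, bil, lorentz, Matrix.mulVec_diagonal, dotProduct, Fin.sum_univ_castSucc,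
    Fin.castSucc_ne_last, sub_eq_add_neg]

theorem lorentz_isSymm : (lorentz n).IsSymm := Matrix.isSymm_diagonal _

theorem lorentzForm_isSymm : (lorentzForm n).IsSymm :=
  Matrix.isSymm_toBilin'_iff_isSymm.mpr lorentz_isSymm

theorem lorentzForm_comm (x y : Vec n) : ⟪x, y⟫ = ⟪y, x⟫ :=
  lorentzForm_isSymm.eq x y

theorem lorentzForm_self_nonneg_of_last_eq_zero {x : Vec n} (hx : x (Fin.last _) = 0) :
    0 ≤ ⟪x, x⟫ := by
  rw [lorentzForm_apply, hx, mul_zero, sub_zero]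
  exact Finset.sum_nonneg fun _ _ => mul_self_nonneg _

theorem last_ne_zero_of_null {x : Vec n} (hx : ⟪x, x⟫ = 0) (h0 : x ≠ 0) :
    x (Fin.last _) ≠ 0 := by
  intro hl
  rw [lorentzForm_apply, hl, mul_zero, sub_zero,
    Finset.sum_eq_zero_iff_of_nonneg fun _ _ => mul_self_nonneg _] at hx
  refine h0 (funext <| Fin.lastCases hl fun i => ?_)
  simpa using hx i (Finset.mem_univ _)

theorem last_smul_eq_of_null_of_orthogonal {x y : Vec n} (hx : ⟪x, x⟫ = 0) (hy : ⟪y, y⟫ = 0)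
    (hxy : ⟪x, y⟫ = 0) : y (Fin.last _) • x = x (Fin.last _) • y := by
  rw [← sub_eq_zero]
  by_contra h
  refine last_ne_zero_of_null ?_ h (by simp [mul_comm])
  simp [hx, hy, hxy, lorentzForm_comm y x]

theorem lorentzForm_self_nonneg_of_orthogonal_null {d x : Vec n} (hx : ⟪x, x⟫ = 0) (h0 : x ≠ 0)
    (hd : ⟪d, x⟫ = 0) : 0 ≤ ⟪d, d⟫ := by
  have key := lorentzForm_self_nonneg_of_last_eq_zero
    (x := x (Fin.last _) • d - d (Fin.last _) • x) (by simp [mul_comm])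
  simp only [map_sub, map_smul, LinearMap.sub_apply, LinearMap.smul_apply, smul_eq_mul, hx, hd,
    lorentzForm_comm x d, mul_zero, sub_zero, ← mul_assoc] at key
  exact nonneg_of_mul_nonneg_right key (mul_self_pos.mpr (last_ne_zero_of_null hx h0))

theorem eq_zero_of_null_of_orthogonal_hyperbolic_pair {d x y : Vec n} (hx : ⟪x, x⟫ = 0)
    (hxy : ⟪x, y⟫ ≠ 0) (hdx : ⟪d, x⟫ = 0) (hdy : ⟪d, y⟫ = 0) (hd : ⟪d, d⟫ = 0) : d = 0 := by
  have h0 : x ≠ 0 := by rintro rfl; simp at hxy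
  have proportional := last_smul_eq_of_null_of_orthogonal hd hx hdx
  have hdl : d (Fin.last _) = 0 := by
    have := congrArg (⟪·, y⟫) proportional
    simpa [hdy, hxy] using this.symm
  rw [hdl, zero_smul] at proportional
  exact (smul_eq_zero.mp proportional).resolve_left (last_ne_zero_of_null hx h0)

theorem lorentzForm_self_pos_of_orthogonal_hyperbolic_pair {d x y : Vec n} (hx : ⟪x, x⟫ = 0)
    (hxy : ⟪x, y⟫ ≠ 0) (hdx : ⟪d, x⟫ = 0) (hdy : ⟪d, y⟫ = 0) (hd : d ≠ 0) : 0 < ⟪d, d⟫ := by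
  have h0 : x ≠ 0 := by rintro rfl; simp at hxy
  exact (lorentzForm_self_nonneg_of_orthogonal_null hx h0 hdx).lt_of_ne fun h =>
    hd (eq_zero_of_null_of_orthogonal_hyperbolic_pair hx hxy hdx hdy h.symm)

theorem isTotallyIsotropic_sub_smul_lorentz_iff {A : Form n} {c : ℝ} {W : Submodule ℝ (Vec n)} :
    IsTotallyIsotropic (A - c • lorentz n).toBilin' W ↔
      ∀ x ∈ W, ∀ y ∈ W, A.toBilin' x y = c * ⟪x, y⟫ := by
  simp [IsTotallyIsotropic, lorentzForm, sub_eq_zero]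

end LorentzForm

section CircularNet

variable {n : ℕ}

theorem mem_sphere_iff {W : Submodule ℝ (Vec n)} {p : RP n} :
    p ∈ sphere W ↔ ⟪p.rep, p.rep⟫ = 0 ∧ p.rep ∈ W := by
  rw [sphere, Set.mem_ofPred_eq, moebiusQuadric, zeroLocus, Set.mem_ofPred_eq,
    Projectivization.submodule_eq, Submodule.span_singleton_le_iff_mem]
  refine and_congr_left fun _ => ⟨fun h => ?_, fun h x hx => ?_⟩
  · rw [← bil_lorentz]
    exact h _ (Submodule.mem_span_singleton_self _)
  · obtain ⟨c, rfl⟩ := Submodule.mem_span_singleton.mp hx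
    simp [bil_lorentz, h]

theorem lorentzForm_rep_ne_zero {p q : RP n} (hp : ⟪p.rep, p.rep⟫ = 0) (hq : ⟪q.rep, q.rep⟫ = 0)
    (h : p ≠ q) : ⟪p.rep, q.rep⟫ ≠ 0 := by
  intro h0
  have hl := last_smul_eq_of_null_of_orthogonal hp hq h0
  have hq0 := last_ne_zero_of_null hq q.rep_nonzero
  refine h ?_
  rw [← p.mk_rep, ← q.mk_rep, Projectivization.mk_eq_mk_iff']
  refine ⟨(q.rep (Fin.last _))⁻¹ * p.rep (Fin.last _), ?_⟩
  rw [mul_smul, ← hl, smul_smul, inv_mul_cancel₀ hq0, one_smul]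

/-- A circular net in homogeneous coordinates: null vectors that represent its vertices, with a
linear relation between the vertices of each quadrilateral. Two null vectors represent different
points exactly when they are not orthogonal. -/
structure NullNet (m : ℤ → ℤ → Vec n) : Prop where
  null : ∀ i j, ⟪m i j, m i j⟫ = 0
  fst : ∀ i j, ⟪m i j, m (i + 1) j⟫ ≠ 0
  snd : ∀ i j, ⟪m i j, m i (j + 1)⟫ ≠ 0
  fst_two : ∀ i j, ⟪m i j, m (i + 2) j⟫ ≠ 0
  snd_two : ∀ i j, ⟪m i j, m i (j + 2)⟫ ≠ 0
  quad : ∀ i j, ∃ a b c d : ℝ, a ≠ 0 ∧ b ≠ 0 ∧ c ≠ 0 ∧ d ≠ 0 ∧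
    a • m i j + b • m (i + 1) j + c • m i (j + 1) + d • m (i + 1) (j + 1) = 0

theorem IsCircularNet.null {M : ℤ → ℤ → RP n} (h : IsCircularNet M) (i j : ℤ) :
    ⟪(M i j).rep, (M i j).rep⟫ = 0 := by
  obtain ⟨W, -, hW, -⟩ := h.quad i j
  exact (mem_sphere_iff.mp hW).1

theorem IsCircularNet.exists_quad_relation {M : ℤ → ℤ → RP n} (h : IsCircularNet M) (i j : ℤ) :
    ∃ a b c d : ℝ, a ≠ 0 ∧ b ≠ 0 ∧ c ≠ 0 ∧ d ≠ 0 ∧ a • (M i j).rep + b • (M (i + 1) j).rep +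
      c • (M i (j + 1)).rep + d • (M (i + 1) (j + 1)).rep = 0 := by
  obtain ⟨W, hW, h00, h10, h11, h01⟩ := h.quad i j
  let P : Fin 4 → RP n := ![M i j, M (i + 1) j, M i (j + 1), M (i + 1) (j + 1)]
  have hP : ∀ k, P k ∈ sphere W := by
    simpa [Fin.forall_fin_succ, P] using ⟨h00, h10, h01, h11⟩
  have distinct : ∀ k l, k ≠ l → P k ≠ P l := by
    have := h.ne_fst i j
    have := h.ne_fst i (j + 1)
    have := h.ne_snd i j
    have := h.ne_snd (i + 1) j
    have := h.ne_diag i j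
    have := h.ne_antidiag i j
    intro k l hkl
    fin_cases k <;> fin_cases l <;> first | exact absurd rfl hkl | assumption | (symm; assumption)
  have hP' := fun k => mem_sphere_iff.mp (hP k)
  obtain ⟨a, ha, e⟩ := exists_relation_of_isotropic_quadruple two_ne_zero lorentzForm_isSymm hW
    (p := fun k => (P k).rep) (fun k => (hP' k).2) (fun k => (hP' k).1)
    fun k l hkl => lorentzForm_rep_ne_zero (hP' k).1 (hP' l).1 (distinct k l hkl)
  rw [Fin.sum_univ_four] at e
  exact ⟨a 0, a 1, a 2, a 3, ha 0, ha 1, ha 2, ha 3, e⟩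

theorem IsCircularNet.nullNet {M : ℤ → ℤ → RP n} (h : IsCircularNet M) :
    NullNet fun i j => (M i j).rep where
  null := h.null
  fst i j := lorentzForm_rep_ne_zero (h.null _ _) (h.null _ _) (h.ne_fst i j)
  snd i j := lorentzForm_rep_ne_zero (h.null _ _) (h.null _ _) (h.ne_snd i j)
  fst_two i j := lorentzForm_rep_ne_zero (h.null _ _) (h.null _ _) (h.ne_fst_two i j)
  snd_two i j := lorentzForm_rep_ne_zero (h.null _ _) (h.null _ _) (h.ne_snd_two i j)
  quad := h.exists_quad_relation

namespace NullNet

variable {m : ℤ → ℤ → Vec n}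

theorem swap (h : NullNet m) : NullNet fun i j => m j i where
  null i j := h.null j i
  fst i j := h.snd j i
  snd i j := h.fst j i
  fst_two i j := h.snd_two j i
  snd_two i j := h.fst_two j i
  quad i j := by
    obtain ⟨a, b, c, d, ha, hb, hc, hd, e⟩ := h.quad j i
    exact ⟨a, c, b, d, ha, hc, hb, hd, by rw [← e]; abel⟩

theorem linearIndependent_fst (h : NullNet m) (i j : ℤ) :
    LinearIndependent ℝ ![m i j, m (i + 1) j, m (i + 2) j] :=
  linearIndependent_of_isotropic_triple two_ne_zero lorentzForm_isSymm (h.null _ _) (h.null _ _)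
    (h.null _ _) (h.fst _ _) (h.fst_two _ _) (by simpa [add_assoc] using h.fst (i + 1) j)

theorem span_fst (h : NullNet m) {H : Submodule ℝ (Vec n)} (hH : Module.finrank ℝ H = 3) {j : ℤ}
    (hm : ∀ i, m i j ∈ H) (i : ℤ) :
    Submodule.span ℝ {m i j, m (i + 1) j, m (i + 2) j} = H :=
  span_triple_eq_of_finrank_eq_three hH (h.linearIndependent_fst i j) (hm _) (hm _) (hm _)

theorem exists_mem_succ (h : NullNet m) {W : Submodule ℝ (Vec n)} {j : ℤ}
    (hm : ∀ i, m i j ∈ W) (i : ℤ) :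
    ∃ a b : ℝ, a ≠ 0 ∧ b ≠ 0 ∧ a • m i (j + 1) + b • m (i + 1) (j + 1) ∈ W := by
  obtain ⟨a, b, c, d, -, -, hc, hd, e⟩ := h.quad i j
  refine ⟨c, d, hc, hd, ?_⟩
  have : c • m i (j + 1) + d • m (i + 1) (j + 1) = -(a • m i j + b • m (i + 1) j) := by
    rw [← sub_eq_zero, ← e]; module
  rw [this]
  exact neg_mem (add_mem (W.smul_mem _ (hm _)) (W.smul_mem _ (hm _)))

theorem exists_mem_pred (h : NullNet m) {W : Submodule ℝ (Vec n)} {j : ℤ}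
    (hm : ∀ i, m i j ∈ W) (i : ℤ) :
    ∃ a b : ℝ, a ≠ 0 ∧ b ≠ 0 ∧ a • m i (j - 1) + b • m (i + 1) (j - 1) ∈ W := by
  obtain ⟨a, b, c, d, ha, hb, -, -, e⟩ := h.quad i (j - 1)
  rw [sub_add_cancel] at e
  refine ⟨a, b, ha, hb, ?_⟩
  have : a • m i (j - 1) + b • m (i + 1) (j - 1) = -(c • m i j + d • m (i + 1) j) := by
    rw [← sub_eq_zero, ← e]; module
  rw [this]
  exact neg_mem (add_mem (W.smul_mem _ (hm _)) (W.smul_mem _ (hm _)))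

end NullNet

end CircularNet

section DarbouxCyclide

variable {n : ℕ} {F : LinearMap.BilinForm ℝ (Vec n)} {m : ℤ → ℤ → Vec n}
  {V H : ℤ → Submodule ℝ (Vec n)}

namespace NullNet

theorem isTotallyIsotropic_of_adjacent (h : NullNet m) (hF : F.IsSymm)
    {W W' : Submodule ℝ (Vec n)} (hW : IsTotallyIsotropic F W) (hW' : Module.finrank ℝ W' = 3)
    {j : ℤ} (hm : ∀ i, m i j ∈ W') (h0 : F (m 0 j) (m 0 j) = 0) (h1 : F (m 1 j) (m 1 j) = 0)
    (h2 : F (m 2 j) (m 2 j) = 0)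
    (hq : ∀ i, ∃ a b : ℝ, a ≠ 0 ∧ b ≠ 0 ∧ a • m i j + b • m (i + 1) j ∈ W) :
    IsTotallyIsotropic F W' := by
  obtain ⟨a, b, ha, hb, hab⟩ := hq 0
  obtain ⟨c, d, hc, hd, hcd⟩ := hq 1
  rw [← h.span_fst hW' hm 0]
  exact hW.span_triple two_ne_zero hF h0 h1 h2 ha hb hc hd hab hcd

theorem isTotallyIsotropic_succ (h : NullNet m) (hF : F.IsSymm)
    (hH : ∀ j, Module.finrank ℝ (H j) = 3) (hm : ∀ i j, m i j ∈ H j) {j : ℤ}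
    (hj : IsTotallyIsotropic F (H j)) (h0 : F (m 0 (j + 1)) (m 0 (j + 1)) = 0)
    (h1 : F (m 1 (j + 1)) (m 1 (j + 1)) = 0) (h2 : F (m 2 (j + 1)) (m 2 (j + 1)) = 0) :
    IsTotallyIsotropic F (H (j + 1)) :=
  h.isTotallyIsotropic_of_adjacent hF hj (hH _) (hm · _) h0 h1 h2 (h.exists_mem_succ (hm · j))

theorem isTotallyIsotropic_of_zero (h : NullNet m) (hF : F.IsSymm)
    (hH : ∀ j, Module.finrank ℝ (H j) = 3) (hm : ∀ i j, m i j ∈ H j)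
    (hH0 : IsTotallyIsotropic F (H 0)) (h0 : ∀ j, F (m 0 j) (m 0 j) = 0)
    (h1 : ∀ j, F (m 1 j) (m 1 j) = 0) (h2 : ∀ j, F (m 2 j) (m 2 j) = 0) (j : ℤ) :
    IsTotallyIsotropic F (H j) := by
  induction j using Int.induction_on with
  | zero => exact hH0
  | succ k ih => exact h.isTotallyIsotropic_succ hF hH hm ih (h0 _) (h1 _) (h2 _)
  | pred k ih =>
    exact h.isTotallyIsotropic_of_adjacent hF ih (hH _) (hm · _) (h0 _) (h1 _) (h2 _)
      (h.exists_mem_pred (hm · _))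

theorem isTotallyIsotropic_of_initial_conditions (h : NullNet m) {A : Form n} (hA : A.IsSymm)
    {c : ℝ} (hV : ∀ i, Module.finrank ℝ (V i) = 3) (hH : ∀ j, Module.finrank ℝ (H j) = 3)
    (hmV : ∀ i j, m i j ∈ V i) (hmH : ∀ i j, m i j ∈ H j)
    (hV0 : IsTotallyIsotropic (A - c • lorentz n).toBilin' (V 0))
    (hH0 : IsTotallyIsotropic A.toBilin' (H 0))
    (hz : ∀ i j : Fin 3, A.toBilin' (m i j) (m i j) = 0) :
    (∀ i, IsTotallyIsotropic (A - c • lorentz n).toBilin' (V i)) ∧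
      ∀ j, IsTotallyIsotropic A.toBilin' (H j) := by
  have hF : A.toBilin'.IsSymm := Matrix.isSymm_toBilin'_iff_isSymm.mpr hA
  have hG : (A - c • lorentz n).toBilin'.IsSymm :=
    Matrix.isSymm_toBilin'_iff_isSymm.mpr (hA.sub (lorentz_isSymm.smul c))
  have hH1 : IsTotallyIsotropic A.toBilin' (H 1) :=
    h.isTotallyIsotropic_succ hF hH hmH hH0 (hz 0 1) (hz 1 1) (hz 2 1)
  have hH2 : IsTotallyIsotropic A.toBilin' (H 2) :=
    h.isTotallyIsotropic_succ hF hH hmH hH1 (hz 0 2) (hz 1 2) (hz 2 2)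
  have null_of_row {j} (hj : IsTotallyIsotropic A.toBilin' (H j)) (i) :
      (A - c • lorentz n).toBilin' (m i j) (m i j) = 0 := by
    have := h.null i j
    rw [lorentzForm] at this
    simp [hj _ (hmH i j) _ (hmH i j), this]
  have hVi := h.swap.isTotallyIsotropic_of_zero hG hV (fun i j => hmV j i) hV0
    (null_of_row hH0) (null_of_row hH1) (null_of_row hH2)
  have null_of_column (i j) : A.toBilin' (m i j) (m i j) = 0 := by
    rw [isTotallyIsotropic_sub_smul_lorentz_iff.mp (hVi i) _ (hmV i j) _ (hmV i j), h.null,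
      mul_zero]
  exact ⟨hVi, h.isTotallyIsotropic_of_zero hF hH hmH hH0 (null_of_column 0) (null_of_column 1)
    (null_of_column 2)⟩

/-- These are fourteen linear conditions on the form, because the proportionality to the Lorentz
product at three pairs of points amounts to two equations. -/
theorem exists_form_initial_conditions (h : NullNet m) (hn : 3 ≤ n) :
    ∃ A : Form n, A ≠ 0 ∧ A.IsSymm ∧ (∀ i j : Fin 3, A.toBilin' (m i j) (m i j) = 0) ∧
      A.toBilin' (m 0 0) (m 1 0) = 0 ∧ A.toBilin' (m 0 0) (m 2 0) = 0 ∧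
      A.toBilin' (m 1 0) (m 2 0) = 0 ∧ ∃ c : ℝ, A.toBilin' (m 0 0) (m 0 1) = c * ⟪m 0 0, m 0 1⟫ ∧
      A.toBilin' (m 0 0) (m 0 2) = c * ⟪m 0 0, m 0 2⟫ ∧
      A.toBilin' (m 0 1) (m 0 2) = c * ⟪m 0 1, m 0 2⟫ := by
  let eval (x y : Vec n) : Form n →ₗ[ℝ] ℝ :=
    LinearMap.applyₗ y ∘ₗ LinearMap.applyₗ x ∘ₗ Matrix.toBilin'.toLinearMap
  have hcard : Fintype.card ((Fin 3 × Fin 3) ⊕ Fin 3 ⊕ Fin 2) <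
      (Fintype.card (Fin (n + 2)) + 1).choose 2 :=
    calc 14 < (5 + 1).choose 2 := by decide
      _ ≤ (Fintype.card (Fin (n + 2)) + 1).choose 2 := Nat.choose_le_choose 2 (by simpa using hn)
  obtain ⟨A, hA0, hA, hf⟩ := exists_symm_of_card_lt (κ := (Fin 3 × Fin 3) ⊕ Fin 3 ⊕ Fin 2)
    (Sum.elim (fun p => eval (m p.1 p.2) (m p.1 p.2)) <| Sum.elim
      ![eval (m 0 0) (m 1 0), eval (m 0 0) (m 2 0), eval (m 1 0) (m 2 0)]
      ![⟪m 0 0, m 0 1⟫ • eval (m 0 0) (m 0 2) - ⟪m 0 0, m 0 2⟫ • eval (m 0 0) (m 0 1),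
        ⟪m 0 0, m 0 1⟫ • eval (m 0 1) (m 0 2) - ⟪m 0 1, m 0 2⟫ • eval (m 0 0) (m 0 1)]) hcard
  have hne : ⟪m 0 0, m 0 1⟫ ≠ 0 := h.snd 0 0
  have h02 : ⟪m 0 0, m 0 1⟫ * A.toBilin' (m 0 0) (m 0 2) -
    ⟪m 0 0, m 0 2⟫ * A.toBilin' (m 0 0) (m 0 1) = 0 := hf (Sum.inr (Sum.inr 0))
  have h12 : ⟪m 0 0, m 0 1⟫ * A.toBilin' (m 0 1) (m 0 2) -
    ⟪m 0 1, m 0 2⟫ * A.toBilin' (m 0 0) (m 0 1) = 0 := hf (Sum.inr (Sum.inr 1))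
  refine ⟨A, hA0, hA, fun i j => hf (Sum.inl (i, j)), hf (Sum.inr (Sum.inl 0)),
    hf (Sum.inr (Sum.inl 1)), hf (Sum.inr (Sum.inl 2)),
    A.toBilin' (m 0 0) (m 0 1) / ⟪m 0 0, m 0 1⟫, ?_, ?_, ?_⟩ <;> field_simp
  · linear_combination h02
  · linear_combination h12

theorem exists_form (h : NullNet m) (hn : 3 ≤ n) (hV : ∀ i, Module.finrank ℝ (V i) = 3)
    (hH : ∀ j, Module.finrank ℝ (H j) = 3) (hmV : ∀ i j, m i j ∈ V i)
    (hmH : ∀ i j, m i j ∈ H j) :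
    ∃ A : Form n, A ≠ 0 ∧ A.IsSymm ∧ ∃ c : ℝ,
      (∀ i, IsTotallyIsotropic (A - c • lorentz n).toBilin' (V i)) ∧
      ∀ j, IsTotallyIsotropic A.toBilin' (H j) := by
  obtain ⟨A, hA0, hA, hz, h01, h02, h12, c, hc01, hc02, hc12⟩ :=
    h.exists_form_initial_conditions hn
  have hG : (A - c • lorentz n).toBilin'.IsSymm :=
    Matrix.isSymm_toBilin'_iff_isSymm.mpr (hA.sub (lorentz_isSymm.smul c))
  have sub_eq {x y} (e : A.toBilin' x y = c * ⟪x, y⟫) : (A - c • lorentz n).toBilin' x y = 0 := by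
    rw [lorentzForm] at e
    simp [e]
  have null (j : Fin 3) : (A - c • lorentz n).toBilin' (m 0 j) (m 0 j) = 0 :=
    sub_eq (by rw [h.null, mul_zero]; exact hz 0 j)
  have hH0 : IsTotallyIsotropic A.toBilin' (H 0) := by
    rw [← h.span_fst (hH 0) (hmH · 0) 0]
    exact isTotallyIsotropic_span_triple (Matrix.isSymm_toBilin'_iff_isSymm.mpr hA)
      (hz 0 0) (hz 1 0) (hz 2 0) h01 h02 h12
  have hV0 : IsTotallyIsotropic (A - c • lorentz n).toBilin' (V 0) := by
    rw [← h.swap.span_fst (hV 0) (hmV 0 ·) 0]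
    exact isTotallyIsotropic_span_triple hG (null 0) (null 1) (null 2) (sub_eq hc01) (sub_eq hc02)
      (sub_eq hc12)
  exact ⟨A, hA0, hA, c, h.isTotallyIsotropic_of_initial_conditions hA hV hH hmV hmH hV0 hH0 hz⟩

end NullNet

theorem sphere_subset_points {D : DarbouxCyclide n} {c : ℝ} {W : Submodule ℝ (Vec n)}
    (h : IsTotallyIsotropic (D.form - c • lorentz n).toBilin' W) : sphere W ⊆ D.points := by
  refine fun p hp => ⟨hp.1, fun x hx => ?_⟩
  rw [bil_eq_toBilin', isTotallyIsotropic_sub_smul_lorentz_iff.mp h x (hp.2 hx) x (hp.2 hx),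
    ← bil_lorentz, hp.1 x hx, mul_zero]

theorem exists_darbouxCyclide_sphere_subset {M : ℤ → ℤ → RP n} (hn : 3 ≤ n)
    (hM : IsCircularNet M) (hc : HasCircularLines M V H) :
    ∃ D : DarbouxCyclide n, (∀ i, sphere (V i) ⊆ D.points) ∧ (∀ j, sphere (H j) ⊆ D.points) := by
  have hmH (i j) : (M i j).rep ∈ H j := (mem_sphere_iff.mp (hc.mem_H i j)).2
  obtain ⟨A, hA0, hA, c, hVA, hHA⟩ := hM.nullNet.exists_form hn hc.finrank_V hc.finrank_H
    (fun i j => (mem_sphere_iff.mp (hc.mem_V i j)).2) hmH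
  have ne_lorentz (r : ℝ) : A ≠ r • lorentz n := by
    rintro rfl
    have h0 : r * ⟪(M 0 0).rep, (M 1 0).rep⟫ = 0 := by
      simpa [lorentzForm] using hHA 0 _ (hmH 0 0) _ (hmH 1 0)
    rw [(mul_eq_zero.mp h0).resolve_right (hM.nullNet.fst 0 0), zero_smul] at hA0
    exact hA0 rfl
  refine ⟨⟨A, hA, ne_lorentz⟩, fun i => sphere_subset_points (hVA i), fun j => ?_⟩
  exact sphere_subset_points (c := 0) (by simpa using hHA j)

end DarbouxCyclide

section Volume

variable {n : ℕ}

theorem lorentz_mul_self : lorentz n * lorentz n = 1 := by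
  rw [lorentz, Matrix.diagonal_mul_diagonal, ← Matrix.diagonal_one]
  congr with k
  split_ifs <;> norm_num

theorem det_lorentz : (lorentz n).det = -1 := by
  simp [lorentz, Matrix.det_diagonal]

theorem det_mul_det_eq_neg_det_gram (a b : Fin (n + 2) → Vec n) :
    (Matrix.of a).det * (Matrix.of b).det = -(Matrix.of fun i j => ⟪a i, b j⟫).det := by
  have gram : (Matrix.of fun i j => ⟪a i, b j⟫) =
      Matrix.of a * lorentz n * (Matrix.of b).transpose := by
    ext i j
    rw [Matrix.mul_assoc, Matrix.of_apply, ← bil_lorentz]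
    simp [bil, dotProduct, Matrix.mulVec, Matrix.mul_apply]
  rw [gram, Matrix.det_mul, Matrix.det_mul, Matrix.det_transpose, det_lorentz]
  ring

theorem det_eq_zero_of_orthogonal {a : Fin (n + 2) → Vec n} {z : Vec n} (hz : z ≠ 0)
    (h : ∀ i, ⟪a i, z⟫ = 0) : (Matrix.of a).det = 0 := by
  refine Matrix.exists_mulVec_eq_zero_iff.mp ⟨(lorentz n).mulVec z, fun h0 => hz ?_, ?_⟩
  · rw [← Matrix.one_mulVec z, ← lorentz_mul_self, ← Matrix.mulVec_mulVec, h0, Matrix.mulVec_zero]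
  · exact funext fun i => (bil_lorentz _ _).trans (h i)

/-- The determinant of four homogeneous coordinate vectors. -/
def vol (x y z w : Vec 2) : ℝ := (Matrix.of ![x, y, z, w]).det

theorem vol_eq (x y z w : Vec 2) : vol x y z w =
    x 0 * (y 1 * (z 2 * w 3 - z 3 * w 2) - y 2 * (z 1 * w 3 - z 3 * w 1)
      + y 3 * (z 1 * w 2 - z 2 * w 1))
    - x 1 * (y 0 * (z 2 * w 3 - z 3 * w 2) - y 2 * (z 0 * w 3 - z 3 * w 0)
      + y 3 * (z 0 * w 2 - z 2 * w 0))
    + x 2 * (y 0 * (z 1 * w 3 - z 3 * w 1) - y 1 * (z 0 * w 3 - z 3 * w 0)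
      + y 3 * (z 0 * w 1 - z 1 * w 0))
    - x 3 * (y 0 * (z 1 * w 2 - z 2 * w 1) - y 1 * (z 0 * w 2 - z 2 * w 0)
      + y 2 * (z 0 * w 1 - z 1 * w 0)) := by
  rw [vol, Matrix.det_succ_row_zero]
  simp [Fin.sum_univ_succ, Matrix.det_fin_three, Matrix.submatrix, Fin.succAbove]
  ring

theorem vol_smul_smul (s t : ℝ) (x y z w : Vec 2) :
    vol (s • x) (t • y) z w = s * t * vol x y z w := by
  simp only [vol_eq, Pi.smul_apply, smul_eq_mul]
  ring

theorem vol_swap_fst_snd (x y z w : Vec 2) : vol y x z w = -vol x y z w := by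
  simp only [vol_eq]
  ring

theorem vol_swap_trd_fth (x y z w : Vec 2) : vol x y w z = -vol x y z w := by
  simp only [vol_eq]
  ring

theorem vol_smul_sub_smul_fst (s t : ℝ) (x x' y z w : Vec 2) :
    vol (s • x - t • x') y z w = s * vol x y z w - t * vol x' y z w := by
  simp only [vol_eq, Pi.sub_apply, Pi.smul_apply, smul_eq_mul]
  ring

theorem vol_sub_add (x y z w d : Vec 2) :
    vol (x - d) (y + d) z w = vol x y z w + vol x d z w - vol d y z w := by
  simp only [vol_eq, Pi.sub_apply, Pi.add_apply]
  ring

theorem vol_smul_eq (x y z w d : Vec 2) : vol x y z w • d =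
    vol d y z w • x + vol x d z w • y + vol x y d w • z + vol x y z d • w := by
  ext k
  simp only [vol_eq, Pi.add_apply, Pi.smul_apply, smul_eq_mul]
  fin_cases k <;> simp <;> ring

theorem vol_mul_vol (x y z w x' y' z' w' : Vec 2) : vol x y z w * vol x' y' z' w' =
    -vol ![⟪x, x'⟫, ⟪x, y'⟫, ⟪x, z'⟫, ⟪x, w'⟫] ![⟪y, x'⟫, ⟪y, y'⟫, ⟪y, z'⟫, ⟪y, w'⟫]
      ![⟪z, x'⟫, ⟪z, y'⟫, ⟪z, z'⟫, ⟪z, w'⟫] ![⟪w, x'⟫, ⟪w, y'⟫, ⟪w, z'⟫, ⟪w, w'⟫] := by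
  simp only [vol, det_mul_det_eq_neg_det_gram]
  congr with i j
  fin_cases i <;> fin_cases j <;> rfl

theorem vol_eq_zero_of_orthogonal {x y z w e : Vec 2} (he : e ≠ 0) (hx : ⟪x, e⟫ = 0)
    (hy : ⟪y, e⟫ = 0) (hz : ⟪z, e⟫ = 0) (hw : ⟪w, e⟫ = 0) : vol x y z w = 0 :=
  det_eq_zero_of_orthogonal he (by simp [Fin.forall_fin_succ, hx, hy, hz, hw])

end Volume

section Edge

variable {n : ℕ}

/-- The Lorentz product of the projections of `x` and `y` to the orthogonal complement of the
edge spanned by the null vectors `m` and `m'`. For unit vectors `x ⟂ m` and `y ⟂ m'` it is the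
cosine of the angle of the projections. -/
noncomputable def edgeCos (m m' x y : Vec n) : ℝ :=
  ⟪x, y⟫ - (⟪x, m⟫ * ⟪y, m'⟫ + ⟪x, m'⟫ * ⟪y, m⟫) / ⟪m, m'⟫

/-- The oriented area of the projections of `x` and `y` to the orthogonal complement of the edge
spanned by `m` and `m'`: the sine that belongs to `edgeCos`. -/
noncomputable def edgeSin (m m' x y : Vec 2) : ℝ := vol m m' x y / ⟪m, m'⟫

theorem edgeCos_smul_smul {a b : ℝ} (ha : a ≠ 0) (hb : b ≠ 0) (m m' x y : Vec n) :
    edgeCos (a • m) (b • m') x y = edgeCos m m' x y := by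
  simp only [edgeCos, map_smul, LinearMap.smul_apply, smul_eq_mul]
  rw [← mul_div_mul_left _ ⟪m, m'⟫ (mul_ne_zero ha hb)]
  ring_nf

theorem edgeSin_smul_smul {a b : ℝ} (ha : a ≠ 0) (hb : b ≠ 0) (m m' x y : Vec 2) :
    edgeSin (a • m) (b • m') x y = edgeSin m m' x y := by
  simp only [edgeSin, vol_smul_smul, map_smul, LinearMap.smul_apply, smul_eq_mul]
  rw [mul_left_comm, ← mul_assoc, mul_div_mul_left _ _ (mul_ne_zero ha hb)]

theorem edgeCos_comm (m m' x y : Vec n) : edgeCos m m' x y = edgeCos m m' y x := by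
  simp only [edgeCos, lorentzForm_comm x y]
  ring

theorem edgeCos_swap (m m' x y : Vec n) : edgeCos m' m x y = edgeCos m m' x y := by
  simp only [edgeCos, lorentzForm_comm m' m]
  ring

theorem edgeSin_swap_swap (m m' x y : Vec 2) : edgeSin m' m y x = edgeSin m m' x y := by
  rw [edgeSin, edgeSin, vol_swap_fst_snd, vol_swap_trd_fth, lorentzForm_comm m' m, neg_neg]

theorem edgeCos_self_eq_one {m m' x : Vec n} (h : ⟪x, m⟫ = 0 ∨ ⟪x, m'⟫ = 0) (hx : ⟪x, x⟫ = 1) :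
    edgeCos m m' x x = 1 := by
  rcases h with h | h <;> simp [edgeCos, h, hx]

theorem edgeCos_eq_of_orthogonal {m m' x y : Vec n} (hm : ⟪y, m⟫ = 0) (hm' : ⟪y, m'⟫ = 0) :
    edgeCos m m' x y = ⟪x, y⟫ := by
  simp [edgeCos, hm, hm']

theorem edgeSin_mul_edgeSin {m m' : Vec 2} (hm : ⟪m, m⟫ = 0) (hm' : ⟪m', m'⟫ = 0)
    (hmm : ⟪m, m'⟫ ≠ 0) (x y z w : Vec 2) : edgeSin m m' x y * edgeSin m m' z w =
      edgeCos m m' x z * edgeCos m m' y w - edgeCos m m' x w * edgeCos m m' y z := by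
  have gram := vol_mul_vol m m' x y m m' z w
  simp only [vol_eq ![_, _, _, _], Matrix.cons_val, hm, hm', lorentzForm_comm m' m,
    lorentzForm_comm m z, lorentzForm_comm m' z, lorentzForm_comm m w, lorentzForm_comm m' w]
    at gram
  simp only [edgeSin, edgeCos]
  field_simp
  linear_combination gram

theorem edgeSin_sq {m m' x y : Vec 2} (hm : ⟪m, m⟫ = 0) (hm' : ⟪m', m'⟫ = 0)
    (hmm : ⟪m, m'⟫ ≠ 0) (hx : edgeCos m m' x x = 1) (hy : edgeCos m m' y y = 1) :
    edgeSin m m' x y ^ 2 = 1 - edgeCos m m' x y ^ 2 := by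
  rw [sq, edgeSin_mul_edgeSin hm hm' hmm, hx, hy, edgeCos_comm m m' y x]
  ring

theorem lorentzForm_sub_edgeCos_mul {m m' x y v : Vec 2} (hm : ⟪m, m⟫ = 0) (hm' : ⟪m', m'⟫ = 0)
    (hmm : ⟪m, m'⟫ ≠ 0) (hy : edgeCos m m' y y = 1) (hv : ⟪v, m⟫ = 0) (hv' : ⟪v, m'⟫ = 0) :
    ⟪x, v⟫ - edgeCos m m' x y * ⟪y, v⟫ = edgeSin m m' x y * edgeSin m m' v y := by
  rw [edgeSin_mul_edgeSin hm hm' hmm, hy, edgeCos_eq_of_orthogonal hv hv',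
    edgeCos_eq_of_orthogonal hv hv', mul_one]

theorem mem_span_pair_of_edgeCos_self_eq_zero {m m' x : Vec n} (hm : ⟪m, m⟫ = 0)
    (hm' : ⟪m', m'⟫ = 0) (hmm : ⟪m, m'⟫ ≠ 0) (hx : edgeCos m m' x x = 0) :
    x ∈ Submodule.span ℝ {m, m'} := by
  have projection_eq_zero : x - (⟪x, m'⟫ / ⟪m, m'⟫) • m - (⟪x, m⟫ / ⟪m, m'⟫) • m' = 0 := by
    refine eq_zero_of_null_of_orthogonal_hyperbolic_pair hm hmm ?_ ?_ ?_
    · simp [hm, lorentzForm_comm m' m, hmm]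
    · simp [hm', hmm]
    · rw [← hx, edgeCos]
      simp only [map_sub, map_smul, LinearMap.sub_apply, LinearMap.smul_apply, smul_eq_mul, hm,
        hm', lorentzForm_comm m' m, lorentzForm_comm m x, lorentzForm_comm m' x]
      field_simp
      ring
  rw [sub_sub, sub_eq_zero] at projection_eq_zero
  exact Submodule.mem_span_pair.mpr ⟨_, _, projection_eq_zero.symm⟩

theorem sub_edgeCos_smul_mem_span_pair {m m' x y : Vec n} (hm : ⟪m, m⟫ = 0)
    (hm' : ⟪m', m'⟫ = 0) (hmm : ⟪m, m'⟫ ≠ 0) (hx : edgeCos m m' x x = 1)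
    (hy : edgeCos m m' y y = 1) (h : edgeCos m m' x y ^ 2 = 1) :
    x - edgeCos m m' x y • y ∈ Submodule.span ℝ {m, m'} := by
  refine mem_span_pair_of_edgeCos_self_eq_zero hm hm' hmm ?_
  have expand (c : ℝ) : edgeCos m m' (x - c • y) (x - c • y) =
      edgeCos m m' x x - 2 * c * edgeCos m m' x y + c ^ 2 * edgeCos m m' y y := by
    simp only [edgeCos, map_sub, map_smul, LinearMap.sub_apply, LinearMap.smul_apply, smul_eq_mul,
      lorentzForm_comm y x]
    ring
  rw [expand, hx, hy]
  linear_combination -h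

/-- The edges `u`, `u'` and `u - d`, `u' + d` are exchanged by the reflection in the hyperplane
orthogonal to `d`, which fixes `x` and `y`. -/
theorem edgeCos_edgeSin_reflection {u u' x y d : Vec 2} (hd : ⟪d, d⟫ ≠ 0) (hu : ⟪u, u⟫ = 0)
    (hu' : ⟪u', u'⟫ = 0) (hud : ⟪u - d, u - d⟫ = 0) (hud' : ⟪u' + d, u' + d⟫ = 0)
    (hx : ⟪x, d⟫ = 0) (hy : ⟪y, d⟫ = 0) :
    edgeCos (u - d) (u' + d) x y = edgeCos u u' x y ∧
      edgeSin (u - d) (u' + d) x y = -edgeSin u u' x y := by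
  have two_ud : 2 * ⟪u, d⟫ = ⟪d, d⟫ := by
    simp only [map_sub, LinearMap.sub_apply, hu, lorentzForm_comm d u] at hud
    linarith
  have two_ud' : 2 * ⟪u', d⟫ = -⟪d, d⟫ := by
    simp only [map_add, LinearMap.add_apply, hu', lorentzForm_comm d u'] at hud'
    linarith
  have product : ⟪u - d, u' + d⟫ = ⟪u, u'⟫ := by
    simp only [map_sub, map_add, LinearMap.sub_apply, lorentzForm_comm d u']
    linarith
  have volume : vol (u - d) (u' + d) x y = -vol u u' x y := by
    have cramer := congrArg (⟪·, d⟫) (vol_smul_eq u u' x y d)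
    simp only [map_add, map_smul, LinearMap.add_apply, LinearMap.smul_apply, smul_eq_mul, hx, hy]
      at cramer
    rw [vol_sub_add]
    apply mul_left_cancel₀ hd
    linear_combination 2 * cramer + vol d u' x y * two_ud + vol u d x y * two_ud'
  constructor
  · rw [edgeCos, edgeCos, product]
    simp [hx, hy]
  · rw [edgeSin, edgeSin, product, volume, neg_div]

theorem edgeCos_edgeSin_of_quad {m₀ m₁ m₀' m₁' x y : Vec 2} (h₀ : ⟪m₀, m₀⟫ = 0)
    (h₁ : ⟪m₁, m₁⟫ = 0) (h₀' : ⟪m₀', m₀'⟫ = 0) (h₁' : ⟪m₁', m₁'⟫ = 0) (h₀₁ : ⟪m₀, m₁⟫ ≠ 0)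
    (x₀ : ⟪x, m₀⟫ = 0) (x₁ : ⟪x, m₁⟫ = 0) (y₀ : ⟪y, m₀'⟫ = 0) (y₁ : ⟪y, m₁'⟫ = 0)
    {a b c d : ℝ} (ha : a ≠ 0) (hb : b ≠ 0) (hc : c ≠ 0) (hd : d ≠ 0)
    (e : a • m₀ + b • m₁ + c • m₀' + d • m₁' = 0) :
    edgeCos m₁ m₁' x y = edgeCos m₀ m₀' x y ∧ edgeSin m₁ m₁' x y = -edgeSin m₀ m₀' x y := by
  have hm₁ : (-b) • m₁ = a • m₀ - (a • m₀ + b • m₁) := by module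
  have hm₁' : (-d) • m₁' = c • m₀' + (a • m₀ + b • m₁) := by
    rw [← sub_eq_zero, ← neg_eq_zero, ← e]; module
  have axis : a • m₀ + b • m₁ = (-c) • m₀' + (-d) • m₁' := by
    rw [← sub_eq_zero, ← e]; module
  rw [← edgeCos_smul_smul (neg_ne_zero.mpr hb) (neg_ne_zero.mpr hd) m₁,
    ← edgeCos_smul_smul ha hc m₀, ← edgeSin_smul_smul (neg_ne_zero.mpr hb) (neg_ne_zero.mpr hd) m₁,
    ← edgeSin_smul_smul ha hc m₀, hm₁, hm₁']
  apply edgeCos_edgeSin_reflection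
  · simp [h₀, h₁, lorentzForm_comm m₁ m₀, ← two_mul, mul_left_comm b a, ha, hb, h₀₁]
  · simp [h₀]
  · simp [h₀']
  · simp [← hm₁, h₁]
  · simp [← hm₁', h₁']
  · simp [x₀, x₁]
  · simp [axis, y₀, y₁]

/-- Both sides are the oriented angle of the two circles at their common point `m'`. -/
theorem edgeSin_congr_left {m m₁ m' v y : Vec 2} (hm' : ⟪m', m'⟫ = 0) (hm : ⟪m, m'⟫ ≠ 0)
    (hm₁ : ⟪m₁, m'⟫ ≠ 0) (hv : ⟪v, m'⟫ = 0) (hy : ⟪y, m'⟫ = 0) :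
    edgeSin m₁ m' v y = edgeSin m m' v y := by
  have h0 : m' ≠ 0 := by rintro rfl; simp at hm
  have key : vol (⟪m, m'⟫ • m₁ - ⟪m₁, m'⟫ • m) m' v y = 0 :=
    vol_eq_zero_of_orthogonal h0 (by simp [mul_comm]) hm' hv hy
  rw [vol_smul_sub_smul_fst] at key
  rw [edgeSin, edgeSin]
  field_simp
  linear_combination key

end Edge

section Normals

variable {n : ℕ}

theorem lorentzForm_nondegenerate : (lorentzForm n).Nondegenerate :=
  LinearMap.BilinForm.nondegenerate_toBilin'_of_det_ne_zero' _ (by simp [det_lorentz])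

theorem eq_zero_of_forall_lorentzForm_eq_zero {x : Vec n} (h : ∀ z, ⟪x, z⟫ = 0) : x = 0 :=
  lorentzForm_nondegenerate.1 x h

theorem finrank_orthogonal_lorentzForm (W : Submodule ℝ (Vec n)) :
    Module.finrank ℝ ((lorentzForm n).orthogonal W) = n + 2 - Module.finrank ℝ W := by
  rw [LinearMap.BilinForm.finrank_orthogonal lorentzForm_nondegenerate, Module.finrank_fin_fun]

theorem mem_orthogonal_span_range_iff {ι : Type*} {a : ι → Vec n} {x : Vec n} :
    x ∈ (lorentzForm n).orthogonal (Submodule.span ℝ (Set.range a)) ↔ ∀ i, ⟪a i, x⟫ = 0 := by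
  change Submodule.span ℝ (Set.range a) ≤ LinearMap.ker ((lorentzForm n).flip x) ↔ _
  rw [Submodule.span_le, Set.range_subset_iff]
  rfl

theorem finrank_orthogonal_span_range {ι : Type*} [Fintype ι] {a : ι → Vec n}
    (ha : LinearIndependent ℝ a) : Module.finrank ℝ
      ((lorentzForm n).orthogonal (Submodule.span ℝ (Set.range a))) = n + 2 - Fintype.card ι := by
  rw [finrank_orthogonal_lorentzForm, finrank_span_eq_card ha]

theorem exists_eq_smul_of_orthogonal {a : Fin (n + 1) → Vec n} (ha : LinearIndependent ℝ a)
    {k x : Vec n} (hk : k ≠ 0) (ka : ∀ i, ⟪a i, k⟫ = 0) (xa : ∀ i, ⟪a i, x⟫ = 0) :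
    ∃ t : ℝ, x = t • k := by
  have finrank_eq_one := finrank_orthogonal_span_range ha
  rw [Fintype.card_fin, Nat.add_sub_add_left] at finrank_eq_one
  obtain ⟨t, ht⟩ := (finrank_eq_one_iff_of_nonzero'
    ⟨k, mem_orthogonal_span_range_iff.mpr ka⟩ (by simpa using hk)).mp finrank_eq_one
    ⟨x, mem_orthogonal_span_range_iff.mpr xa⟩
  exact ⟨t, congrArg Subtype.val ht.symm⟩

theorem exists_coeff_of_orthogonal {x y z k w : Vec 2} (h : LinearIndependent ℝ ![x, y, z])
    (hk : k ≠ 0) (kx : ⟪k, x⟫ = 0) (ky : ⟪k, y⟫ = 0) (kz : ⟪k, z⟫ = 0) (kw : ⟪k, w⟫ = 0) :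
    ∃ a b c : ℝ, a • x + b • y + c • z = w := by
  refine exists_coeff_of_mem (W := (lorentzForm 2).orthogonal (Submodule.span ℝ (Set.range ![k])))
    ?_ h ?_ ?_ ?_ ?_
  · simpa using finrank_orthogonal_span_range (a := ![k]) (by simpa using hk)
  all_goals rw [mem_orthogonal_span_range_iff]; simpa

/-- `h` is a unit normal vector of the hyperplane `W` with respect to the Lorentz product. -/
structure IsUnitNormal (h : Vec n) (W : Submodule ℝ (Vec n)) : Prop where
  unit : ⟪h, h⟫ = 1
  mem_iff : ∀ w, w ∈ W ↔ ⟪h, w⟫ = 0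

theorem exists_isUnitNormal {W : Submodule ℝ (Vec n)} (hW : Module.finrank ℝ W = n + 1)
    {x y : Vec n} (hx : x ∈ W) (hy : y ∈ W) (hxx : ⟪x, x⟫ = 0) (hxy : ⟪x, y⟫ ≠ 0) :
    ∃ h, IsUnitNormal h W := by
  obtain ⟨⟨g, g_mem⟩, g_ne, g_span⟩ := finrank_eq_one_iff'.mp <| show Module.finrank ℝ
      ((lorentzForm n).orthogonal W) = 1 by rw [finrank_orthogonal_lorentzForm, hW]; omega
  have mem_iff (w : Vec n) : w ∈ W ↔ ⟪g, w⟫ = 0 := by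
    refine ⟨fun hw => by rw [lorentzForm_comm]; exact g_mem w hw, fun hw => ?_⟩
    rw [← LinearMap.BilinForm.orthogonal_orthogonal lorentzForm_nondegenerate
      lorentzForm_isSymm.isRefl W]
    intro z hz
    obtain ⟨c, hc⟩ := g_span ⟨z, hz⟩
    obtain rfl : c • g = z := congrArg Subtype.val hc
    simp [hw]
  have g_pos : 0 < ⟪g, g⟫ := lorentzForm_self_pos_of_orthogonal_hyperbolic_pair hxx hxy
    ((mem_iff x).mp hx) ((mem_iff y).mp hy) (by simpa using g_ne)
  refine ⟨(√⟪g, g⟫)⁻¹ • g, ?_, fun w => ?_⟩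
  · simp only [map_smul, LinearMap.smul_apply, smul_eq_mul]
    field_simp
    exact (Real.sq_sqrt g_pos.le).symm
  · simp [mem_iff, (Real.sqrt_pos.mpr g_pos).ne']

theorem linearIndependent_of_isUnitNormal {ι : Type*} [Fintype ι] {h : ι → Vec n}
    {W : ι → Submodule ℝ (Vec n)} (hh : ∀ i, IsUnitNormal (h i) (W i))
    (hW : Fintype.card ι + Module.finrank ℝ (⨅ i, W i : Submodule ℝ (Vec n)) ≤ n + 2) :
    LinearIndependent ℝ h := by
  have orthogonal_eq :
      (lorentzForm n).orthogonal (Submodule.span ℝ (Set.range h)) = ⨅ i, W i := by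
    ext x
    simp only [mem_orthogonal_span_range_iff, Submodule.mem_iInf, (hh _).mem_iff]
  have span_le := Submodule.finrank_le (Submodule.span ℝ (Set.range h))
  rw [Module.finrank_fin_fun] at span_le
  rw [← orthogonal_eq, finrank_orthogonal_lorentzForm] at hW
  rw [linearIndependent_iff_card_le_finrank_span, Set.finrank]
  omega

theorem GeneralPosition.inGeneralPosition {W : ℤ → Submodule ℝ (Vec 2)} (hW : GeneralPosition W)
    {h : ℤ → Vec 2} (hh : ∀ i, IsUnitNormal (h i) (W i)) : InGeneralPosition ℝ h := by
  intro i k l hik hkl hil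
  refine linearIndependent_of_isUnitNormal (W := ![W i, W k, W l]) ?_ ?_
  · simp [Fin.forall_fin_succ, hh]
  · have finrank_le := hW.not_coaxial i k l hik hkl hil
    have iInf_eq : ⨅ x, ![W i, W k, W l] x = W i ⊓ W k ⊓ W l := by
      ext x
      simp [Submodule.mem_iInf, Fin.forall_fin_succ, and_assoc]
    rw [iInf_eq, Fintype.card_fin]
    omega

end Normals

section Strip

variable {m : ℤ → ℤ → Vec 2} {v h : ℤ → Vec 2}

/-- A net of null vectors with circular parameter lines: `v i` and `h j` are unit normals of the
planes of the circles through the points `m i j` with fixed `i` and with fixed `j`. The normals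
of each family are in general position. -/
structure CircleNet (m : ℤ → ℤ → Vec 2) (v h : ℤ → Vec 2) : Prop extends NullNet m where
  unit_fst : ∀ i, ⟪v i, v i⟫ = 1
  unit_snd : ∀ j, ⟪h j, h j⟫ = 1
  orthogonal_fst : ∀ i j, ⟪v i, m i j⟫ = 0
  orthogonal_snd : ∀ i j, ⟪h j, m i j⟫ = 0
  general_fst : InGeneralPosition ℝ v
  general_snd : InGeneralPosition ℝ h

/-- The cosine of the angle of the circles with normals `h j` and `h (j + 1)`, measured along the
edge from `m i j` to `m i (j + 1)`. -/
noncomputable def stripCos (m : ℤ → ℤ → Vec 2) (h : ℤ → Vec 2) (i j : ℤ) : ℝ :=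
  edgeCos (m i j) (m i (j + 1)) (h j) (h (j + 1))

/-- The sine that belongs to `stripCos`. -/
noncomputable def stripSin (m : ℤ → ℤ → Vec 2) (h : ℤ → Vec 2) (i j : ℤ) : ℝ :=
  edgeSin (m i j) (m i (j + 1)) (h j) (h (j + 1))

namespace CircleNet

theorem eq_smul_of_incident (hm : CircleNet m v h) {g : Vec 2} {j : ℤ}
    (step : ∀ i, ⟪g, m i j⟫ = 0 → ⟪g, m (i + 1) j⟫ = 0) {i : ℤ} (hi : ⟪g, m i j⟫ = 0) :
    ∃ c : ℝ, g = c • h j := by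
  have h_ne : h j ≠ 0 := by
    intro h0
    simpa [h0] using hm.unit_snd j
  refine exists_eq_smul_of_orthogonal (hm.linearIndependent_fst i j) h_ne ?_ ?_
  · simp [Fin.forall_fin_succ, lorentzForm_comm _ (h j), hm.orthogonal_snd]
  · have h1 := step _ hi
    have h2 := step _ h1
    rw [add_assoc, one_add_one_eq_two] at h2
    simp [Fin.forall_fin_succ, lorentzForm_comm _ g, hi, h1, h2]

theorem lorentzForm_succ_ne_zero (hm : CircleNet m v h) (i j : ℤ) : ⟪h (j + 1), m i j⟫ ≠ 0 := by
  intro incident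
  obtain ⟨c, hc⟩ := hm.eq_smul_of_incident (fun i hi => by
    obtain ⟨a, b, c, d, -, hb, -, -, e⟩ := hm.quad i j
    simpa [hi, hm.orthogonal_snd, hb] using congrArg (⟪h (j + 1), ·⟫) e) incident
  exact hm.general_snd.ne_smul (by simp) c hc

theorem lorentzForm_pred_ne_zero (hm : CircleNet m v h) (i j : ℤ) : ⟪h j, m i (j + 1)⟫ ≠ 0 := by
  intro incident
  obtain ⟨c, hc⟩ := hm.eq_smul_of_incident (fun i hi => by
    obtain ⟨a, b, c, d, -, -, -, hd, e⟩ := hm.quad i j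
    simpa [hi, hm.orthogonal_snd, hd] using congrArg (⟪h j, ·⟫) e) incident
  exact hm.general_snd.ne_smul (by simp) c hc

theorem stripCos_ne (hm : CircleNet m v h) (i j : ℤ) : stripCos m h i j ≠ ⟪h j, h (j + 1)⟫ := by
  have h1 := hm.lorentzForm_succ_ne_zero i j
  have h2 := hm.lorentzForm_pred_ne_zero i j
  have h3 := hm.snd i j
  simp [stripCos, edgeCos, hm.orthogonal_snd, h1, h2, h3]

theorem edgeCos_self_fst (hm : CircleNet m v h) (i j : ℤ) :
    edgeCos (m i j) (m i (j + 1)) (v i) (v i) = 1 :=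
  edgeCos_self_eq_one (.inl (hm.orthogonal_fst i j)) (hm.unit_fst i)

theorem edgeCos_self_snd (hm : CircleNet m v h) (i j : ℤ) :
    edgeCos (m i j) (m i (j + 1)) (h j) (h j) = 1 :=
  edgeCos_self_eq_one (.inl (hm.orthogonal_snd i j)) (hm.unit_snd j)

theorem edgeCos_self_snd_succ (hm : CircleNet m v h) (i j : ℤ) :
    edgeCos (m i j) (m i (j + 1)) (h (j + 1)) (h (j + 1)) = 1 :=
  edgeCos_self_eq_one (.inr (hm.orthogonal_snd i (j + 1))) (hm.unit_snd (j + 1))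

theorem stripSin_sq (hm : CircleNet m v h) (i j : ℤ) :
    stripSin m h i j ^ 2 = 1 - stripCos m h i j ^ 2 :=
  edgeSin_sq (hm.null _ _) (hm.null _ _) (hm.snd _ _) (hm.edgeCos_self_snd i j)
    (hm.edgeCos_self_snd_succ i j)

theorem strip_succ (hm : CircleNet m v h) (i j : ℤ) :
    stripCos m h (i + 1) j = stripCos m h i j ∧ stripSin m h (i + 1) j = -stripSin m h i j := by
  obtain ⟨a, b, c, d, ha, hb, hc, hd, e⟩ := hm.quad i j
  exact edgeCos_edgeSin_of_quad (hm.null _ _) (hm.null _ _) (hm.null _ _) (hm.null _ _)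
    (hm.fst _ _) (hm.orthogonal_snd _ _) (hm.orthogonal_snd _ _) (hm.orthogonal_snd _ _)
    (hm.orthogonal_snd _ _) ha hb hc hd e

theorem stripCos_eq (hm : CircleNet m v h) (i j : ℤ) : stripCos m h i j = stripCos m h 0 j := by
  induction i using Int.induction_on with
  | zero => rfl
  | succ k ih => rw [(hm.strip_succ _ _).1, ih]
  | pred k ih => rw [← ih, ← (hm.strip_succ (-(k : ℤ) - 1) j).1, sub_add_cancel]

theorem stripSin_eq (hm : CircleNet m v h) (i j : ℤ) :
    stripSin m h i j = (-1) ^ i * stripSin m h 0 j := by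
  induction i using Int.induction_on with
  | zero => simp
  | succ k ih => rw [(hm.strip_succ _ _).2, ih, zpow_add_one₀ (by simp)]; ring
  | pred k ih =>
    have step := (hm.strip_succ (-(k : ℤ) - 1) j).2
    rw [sub_add_cancel, ih] at step
    rw [zpow_sub_one₀ (by simp), inv_neg_one]
    linarith

theorem stripSin_ne_zero (hm : CircleNet m v h) {j : ℤ}
    (edges : ∀ x, (∀ i, x ∈ Submodule.span ℝ {m i j, m i (j + 1)}) → x = 0) :
    stripSin m h 0 j ≠ 0 := by
  intro sin_eq_zero
  have cos_sq (i : ℤ) : stripCos m h i j ^ 2 = 1 := by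
    have sin_sq := hm.stripSin_sq 0 j
    rw [sin_eq_zero] at sin_sq
    rw [hm.stripCos_eq]
    linarith
  have common := edges (h j - stripCos m h 0 j • h (j + 1)) fun i => by
    rw [← hm.stripCos_eq i]
    exact sub_edgeCos_smul_mem_span_pair (hm.null _ _) (hm.null _ _) (hm.snd _ _)
      (hm.edgeCos_self_snd i j) (hm.edgeCos_self_snd_succ i j) (cos_sq i)
  exact hm.general_snd.ne_smul (by simp) _ (sub_eq_zero.mp common)

theorem lorentzForm_sub_stripCos_mul (hm : CircleNet m v h) (i j : ℤ) :
    ⟪h j, v i⟫ - stripCos m h i j * ⟪h (j + 1), v i⟫ =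
      stripSin m h i j * edgeSin (m i j) (m i (j + 1)) (v i) (h (j + 1)) :=
  lorentzForm_sub_edgeCos_mul (hm.null _ _) (hm.null _ _) (hm.snd _ _)
    (hm.edgeCos_self_snd_succ i j) (hm.orthogonal_fst _ _) (hm.orthogonal_fst _ _)

/-- The angle of the two circles at `m i (j + 1)` is seen from both edges at that point. -/
theorem lorentzForm_sub_stripCos_succ_mul (hm : CircleNet m v h) (i j : ℤ) :
    ⟪h (j + 2), v i⟫ - stripCos m h i (j + 1) * ⟪h (j + 1), v i⟫ =
      stripSin m h i (j + 1) * edgeSin (m i j) (m i (j + 1)) (v i) (h (j + 1)) := by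
  have hmm : ⟪m i (j + 2), m i (j + 1)⟫ ≠ 0 := by
    simpa [lorentzForm_comm, add_assoc] using hm.snd i (j + 1)
  have key := lorentzForm_sub_edgeCos_mul (x := h (j + 2)) (hm.null i (j + 2)) (hm.null i (j + 1))
    hmm (edgeCos_self_eq_one (.inr (hm.orthogonal_snd i (j + 1))) (hm.unit_snd (j + 1)))
    (hm.orthogonal_fst i _) (hm.orthogonal_fst i _)
  rw [edgeSin_congr_left (hm.null _ _) (hm.snd i j) hmm (hm.orthogonal_fst _ _)
    (hm.orthogonal_snd _ _), edgeCos_swap, edgeCos_comm, edgeSin_swap_swap] at key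
  rw [show j + 2 = j + 1 + 1 by ring] at key ⊢
  exact key

end CircleNet

/-- The angles of the vectors `v i` with the vectors `h j` satisfy an addition theorem with
constants that do not depend on `i`: the angles of `v i` with `h j` and with `h (j + 1)` differ by
an angle with cosine `s j` and sine `r j`, where the angle of `v i` with `h (j + 1)`, with sine
`w`, enters in the same way into the strip `j` and into the strip `j + 1`. -/
structure StripAngles (v h : ℤ → Vec 2) (s r : ℤ → ℝ) : Prop where
  unit_fst : ∀ i, ⟪v i, v i⟫ = 1
  unit_snd : ∀ j, ⟪h j, h j⟫ = 1
  general_fst : InGeneralPosition ℝ v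
  general_snd : InGeneralPosition ℝ h
  sin_sq : ∀ j, r j ^ 2 = 1 - s j ^ 2
  sin_ne_zero : ∀ j, r j ≠ 0
  cos_ne : ∀ j, s j ≠ ⟪h j, h (j + 1)⟫
  angle : ∀ i j, ∃ w, ⟪h j, v i⟫ - s j * ⟪h (j + 1), v i⟫ = r j * w ∧
    ⟪h (j + 2), v i⟫ - s (j + 1) * ⟪h (j + 1), v i⟫ = r (j + 1) * w ∧
    w ^ 2 = 1 - ⟪h (j + 1), v i⟫ ^ 2

theorem CircleNet.stripAngles (hm : CircleNet m v h)
    (edges : ∀ j x, (∀ i, x ∈ Submodule.span ℝ {m i j, m i (j + 1)}) → x = 0) :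
    StripAngles v h (stripCos m h 0) (stripSin m h 0) where
  unit_fst := hm.unit_fst
  unit_snd := hm.unit_snd
  general_fst := hm.general_fst
  general_snd := hm.general_snd
  sin_sq := hm.stripSin_sq 0
  sin_ne_zero j := hm.stripSin_ne_zero (edges j)
  cos_ne := hm.stripCos_ne 0
  angle i j := by
    have h0 := hm.lorentzForm_sub_stripCos_mul i j
    have h1 := hm.lorentzForm_sub_stripCos_succ_mul i j
    rw [hm.stripCos_eq i, hm.stripSin_eq i] at h0 h1
    refine ⟨(-1) ^ i * edgeSin (m i j) (m i (j + 1)) (v i) (h (j + 1)), by rw [h0]; ring,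
      by rw [h1]; ring, ?_⟩
    rw [mul_pow, ← zpow_natCast, ← zpow_mul, Even.neg_one_zpow (by simp), one_mul,
      edgeSin_sq (hm.null _ _) (hm.null _ _) (hm.snd _ _) (hm.edgeCos_self_fst i j)
      (hm.edgeCos_self_snd_succ i j), edgeCos_comm,
      edgeCos_eq_of_orthogonal (hm.orthogonal_fst _ _) (hm.orthogonal_fst _ _)]

end Strip

section FivePoints

variable {𝕜 E : Type*} [Field 𝕜] [AddCommGroup E] [Module 𝕜 E] {F : LinearMap.BilinForm 𝕜 E}
  {W : Submodule 𝕜 E}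

theorem eq_neg_of_isotropic_combination (h2 : (2 : 𝕜) ≠ 0) (hF : F.IsSymm) {x y z : E}
    (hx : F x x = 0) (hy : F y y = 0) (hz : F z z = 0) (hxy : F x y = 0) {a b c : 𝕜} (hc : c ≠ 0)
    (h : F (a • x + b • y + c • z) (a • x + b • y + c • z) = 0) :
    a * F x z = -(b * F y z) := by
  simp only [map_add, map_smul, LinearMap.add_apply, LinearMap.smul_apply, smul_eq_mul, hx, hy, hz,
    hF.eq y x, hF.eq z x, hF.eq z y, hxy] at h
  have : 2 * c * (a * F x z + b * F y z) = 0 := by linear_combination h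
  exact eq_neg_of_add_eq_zero_left (by simpa [h2, hc] using this)

/-- If two of the five points are conjugate, then the conic contains the line through them, and the
other three points would have to lie on the remaining line. -/
theorem isTotallyIsotropic_of_five_points (h2 : (2 : 𝕜) ≠ 0) (hF : F.IsSymm)
    (hW : Module.finrank 𝕜 W = 3) {p : Fin 5 → E} (hpW : ∀ i, p i ∈ W)
    (hp : ∀ i, F (p i) (p i) = 0) (general : InGeneralPosition 𝕜 p) (h01 : F (p 0) (p 1) = 0) :
    IsTotallyIsotropic F W := by
  have coeff_eq_zero (i j k) (hij : i ≠ j) (hjk : j ≠ k) (hik : i ≠ k) :=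
    linearIndependent_triple_iff.mp (general i j k hij hjk hik)
  have independent := general 0 1 2 (by decide) (by decide) (by decide)
  obtain ⟨a, b, c, e3⟩ := exists_coeff_of_mem hW independent (hpW 0) (hpW 1) (hpW 2) (hpW 3)
  obtain ⟨a', b', c', e4⟩ := exists_coeff_of_mem hW independent (hpW 0) (hpW 1) (hpW 2) (hpW 4)
  have hc : c ≠ 0 := by
    rintro rfl
    simpa using coeff_eq_zero 0 1 3 (by decide) (by decide) (by decide) a b (-1)
      (by rw [← e3]; module)
  have hc' : c' ≠ 0 := by
    rintro rfl
    simpa using coeff_eq_zero 0 1 4 (by decide) (by decide) (by decide) a' b' (-1)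
      (by rw [← e4]; module)
  have ha' : a' ≠ 0 := by
    rintro rfl
    simpa using coeff_eq_zero 1 2 4 (by decide) (by decide) (by decide) b' c' (-1)
      (by rw [← e4]; module)
  have q3 : a * F (p 0) (p 2) = -(b * F (p 1) (p 2)) :=
    eq_neg_of_isotropic_combination h2 hF (hp 0) (hp 1) (hp 2) h01 hc (by rw [e3, hp])
  have q4 : a' * F (p 0) (p 2) = -(b' * F (p 1) (p 2)) :=
    eq_neg_of_isotropic_combination h2 hF (hp 0) (hp 1) (hp 2) h01 hc' (by rw [e4, hp])
  have h12 : F (p 1) (p 2) = 0 := by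
    by_contra h12
    have proportional : a' * b = a * b' := by
      apply mul_left_cancel₀ h12
      linear_combination a' * q3 - a * q4
    have := coeff_eq_zero 3 4 2 (by decide) (by decide) (by decide) a' (-a) (a * c' - a' * c) (by
      rw [← e3, ← e4]
      linear_combination (norm := module) proportional • p 1)
    exact ha' this.1
  have h02 : F (p 0) (p 2) = 0 := by simpa [h12, ha'] using q4
  rw [← span_triple_eq_of_finrank_eq_three hW independent (hpW 0) (hpW 1) (hpW 2)]
  exact isTotallyIsotropic_span_triple hF (hp 0) (hp 1) (hp 2) h01 h02 h12

end FivePoints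

section Operators

variable {n : ℕ} {h h' k x y : Vec n} {s r : ℝ}

theorem exists_lorentzForm_eq {ι : Type*} [Finite ι] {a : ι → Vec n} (ha : LinearIndependent ℝ a)
    (c : ι → ℝ) : ∃ x, ∀ i, ⟪a i, x⟫ = c i := by
  have := Fintype.ofFinite ι
  let f : Vec n →ₗ[ℝ] ι → ℝ := LinearMap.pi fun i => lorentzForm n (a i)
  have ker_eq : LinearMap.ker f = (lorentzForm n).orthogonal (Submodule.span ℝ (Set.range a)) := by
    ext x
    rw [mem_orthogonal_span_range_iff, LinearMap.mem_ker, funext_iff]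
    rfl
  have rank_nullity := f.finrank_range_add_finrank_ker
  have card_le := ha.fintype_card_le_finrank
  rw [ker_eq, finrank_orthogonal_span_range ha, Module.finrank_fin_fun] at rank_nullity
  rw [Module.finrank_fin_fun] at card_le
  have range_eq_top : LinearMap.range f = ⊤ := by
    apply Submodule.eq_top_of_finrank_eq
    rw [Module.finrank_fintype_fun_eq_card]
    omega
  obtain ⟨x, hx⟩ := LinearMap.range_eq_top.mp range_eq_top c
  exact ⟨x, congrFun hx⟩

/-- The image of the subspace under the operator is contained in its orthogonal complement. -/
theorem IsTotallyIsotropic.two_mul_finrank_le {T : Vec n →ₗ[ℝ] Vec n}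
    (hT : Function.Injective T) {W : Submodule ℝ (Vec n)}
    (hW : IsTotallyIsotropic ((lorentzForm n).compRight T) W) :
    2 * Module.finrank ℝ W ≤ n + 2 := by
  have map_le : W.map T ≤ (lorentzForm n).orthogonal W := by
    rintro _ ⟨y, hy, rfl⟩ x hx
    exact hW x hx y hy
  have finrank_le := Submodule.finrank_mono map_le
  have finrank_le_dim := Submodule.finrank_le W
  rw [← (W.equivMapOfInjective T hT).finrank_eq, finrank_orthogonal_lorentzForm] at finrank_le
  rw [Module.finrank_fin_fun] at finrank_le_dim
  omega

/-- The operator of a quadric in the pencil that the pair of hyperplanes with normals `h`, `h'`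
spans with the Möbius quadric. The parameter `s` is chosen such that `ruledDual h h' s` is the
operator of the dual quadric if `h` and `h'` are unit vectors. -/
noncomputable def ruledOp (h h' : Vec n) (s : ℝ) : Vec n →ₗ[ℝ] Vec n :=
  LinearMap.id + (s - ⟪h, h'⟫)⁻¹ •
    ((lorentzForm n h').smulRight h + (lorentzForm n h).smulRight h')

/-- The inverse of `ruledOp h h' s`, for unit vectors `h` and `h'`. -/
noncomputable def ruledDual (h h' : Vec n) (s : ℝ) : Vec n →ₗ[ℝ] Vec n :=
  LinearMap.id - (1 - s ^ 2)⁻¹ •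
    ((lorentzForm n h - s • lorentzForm n h').smulRight h +
      (lorentzForm n h' - s • lorentzForm n h).smulRight h')

theorem ruledOp_apply : ruledOp h h' s x = x + (s - ⟪h, h'⟫)⁻¹ • (⟪h', x⟫ • h + ⟪h, x⟫ • h') := rfl

theorem ruledDual_apply : ruledDual h h' s x =
    x - (1 - s ^ 2)⁻¹ • ((⟪h, x⟫ - s * ⟪h', x⟫) • h + (⟪h', x⟫ - s * ⟪h, x⟫) • h') := rfl

theorem lorentzForm_ruledOp : ⟪x, ruledOp h h' s y⟫ = ⟪ruledOp h h' s x, y⟫ := by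
  simp only [ruledOp_apply, map_add, map_smul, LinearMap.add_apply, LinearMap.smul_apply,
    smul_eq_mul, lorentzForm_comm x]
  ring

theorem lorentzForm_ruledDual : ⟪x, ruledDual h h' s y⟫ = ⟪ruledDual h h' s x, y⟫ := by
  simp only [ruledDual_apply, map_add, map_sub, map_smul, LinearMap.add_apply, LinearMap.sub_apply,
    LinearMap.smul_apply, smul_eq_mul, lorentzForm_comm x]
  ring

theorem ruledDual_isSymm : ((lorentzForm n).compRight (ruledDual h h' s)).IsSymm :=
  ⟨fun x y => by
    simp only [LinearMap.BilinForm.compRight_apply]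
    rw [lorentzForm_ruledDual, lorentzForm_comm]⟩

theorem ruledOp_ruledDual (unit : ⟪h, h⟫ = 1) (unit' : ⟪h', h'⟫ = 1) (hs : 1 - s ^ 2 ≠ 0)
    (hne : s ≠ ⟪h, h'⟫) : ruledOp h h' s (ruledDual h h' s x) = x := by
  have ht : s - ⟪h, h'⟫ ≠ 0 := sub_ne_zero.mpr hne
  rw [ruledOp_apply]
  simp only [ruledDual_apply, map_sub, map_add, map_smul, smul_eq_mul, unit, unit',
    lorentzForm_comm h' h]
  set X := ⟪h, x⟫
  set Y := ⟪h', x⟫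
  set b := ⟪h, h'⟫
  have coeff_h : (s - b)⁻¹ * (Y - (1 - s ^ 2)⁻¹ * ((X - s * Y) * b + (Y - s * X) * 1))
      = (1 - s ^ 2)⁻¹ * (X - s * Y) := by
    field_simp
    ring
  have coeff_h' : (s - b)⁻¹ * (X - (1 - s ^ 2)⁻¹ * ((X - s * Y) * 1 + (Y - s * X) * b))
      = (1 - s ^ 2)⁻¹ * (Y - s * X) := by
    field_simp
    ring
  linear_combination (norm := module) coeff_h • h + coeff_h' • h'

theorem ruledDual_ruledOp (unit : ⟪h, h⟫ = 1) (unit' : ⟪h', h'⟫ = 1) (hs : 1 - s ^ 2 ≠ 0)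
    (hne : s ≠ ⟪h, h'⟫) : ruledDual h h' s (ruledOp h h' s x) = x := by
  have right_inverse : ruledOp h h' s * ruledDual h h' s = 1 :=
    LinearMap.ext fun _ => ruledOp_ruledDual unit unit' hs hne
  exact LinearMap.congr_fun (mul_eq_one_comm.mp right_inverse) x

theorem ruledDual_swap : ruledDual h' h s x = ruledDual h h' s x := by
  rw [ruledDual_apply, ruledDual_apply, add_comm (_ • h')]

/-- The projection onto the plane of `h` and `h'` is computed in the orthogonal basis that consists
of `h'` and `h - s • h'`, as if `h` and `h'` had the inner product `s`. -/
theorem ruledDual_eq (hr : r ≠ 0) (hrs : r ^ 2 = 1 - s ^ 2) : ruledDual h h' s x =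
    x - ⟪h', x⟫ • h' - ((r ^ 2)⁻¹ * (⟪h, x⟫ - s * ⟪h', x⟫)) • (h - s • h') := by
  rw [ruledDual_apply, ← hrs]
  have coeff_h' : (r ^ 2)⁻¹ * (⟪h', x⟫ - s * ⟪h, x⟫) =
      ⟪h', x⟫ - s * ((r ^ 2)⁻¹ * (⟪h, x⟫ - s * ⟪h', x⟫)) := by
    field_simp
    linear_combination (-⟪h', x⟫) * hrs
  rw [smul_add, smul_smul, smul_smul, coeff_h']
  module

theorem linearIndependent_ruledOp (ind : LinearIndependent ℝ ![h, h', k]) :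
    LinearIndependent ℝ ![h, h', ruledOp h h' s k] := by
  rw [linearIndependent_triple_iff] at ind ⊢
  intro a b c e
  rw [ruledOp_apply] at e
  obtain ⟨ha, hb, rfl⟩ := ind (a + c * ((s - ⟪h, h'⟫)⁻¹ * ⟪h', k⟫))
    (b + c * ((s - ⟪h, h'⟫)⁻¹ * ⟪h, k⟫)) c (by rw [← e]; module)
  exact ⟨by simpa using ha, by simpa using hb, rfl⟩

/-- The operator of the cone with apex `k` that touches the quadric of the operator `R` along a
conic. -/
noncomputable def tangentCone (R : Vec n →ₗ[ℝ] Vec n) (k : Vec n) : Vec n →ₗ[ℝ] Vec n :=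
  R - ⟪k, R k⟫⁻¹ • ((lorentzForm n k).comp R).smulRight (R k)

variable {R : Vec n →ₗ[ℝ] Vec n}

theorem tangentCone_apply :
    tangentCone R k x = R x - (⟪k, R k⟫⁻¹ * ⟪k, R x⟫) • R k := by
  rw [← smul_smul]
  rfl

theorem tangentCone_apply_self (hk : ⟪k, R k⟫ ≠ 0) : tangentCone R k k = 0 := by
  rw [tangentCone_apply, inv_mul_cancel₀ hk, one_smul, sub_self]

theorem tangentCone_apply_of_orthogonal (hx : ⟪k, R x⟫ = 0) : tangentCone R k x = R x := by
  rw [tangentCone_apply, hx, mul_zero, zero_smul, sub_zero]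

theorem lorentzForm_tangentCone (hR : ∀ x y, ⟪x, R y⟫ = ⟪R x, y⟫) :
    ⟪x, tangentCone R k y⟫ = ⟪tangentCone R k x, y⟫ := by
  have comm : ⟪k, R y⟫ * ⟪x, R k⟫ = ⟪k, R x⟫ * ⟪R k, y⟫ := by
    rw [hR x k, lorentzForm_comm (R x), hR k y, mul_comm]
  simp only [tangentCone_apply, map_sub, map_smul, LinearMap.sub_apply, LinearMap.smul_apply,
    smul_eq_mul]
  linear_combination hR x y - ⟪k, R k⟫⁻¹ * comm

end Operators

theorem exists_injective_fin_five {ι : Type*} [Infinite ι] {a b : ι} (hab : a ≠ b) :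
    ∃ f : Fin 5 → ι, f 0 = a ∧ f 1 = b ∧ Function.Injective f := by
  classical
  obtain ⟨c, hc⟩ := Infinite.exists_notMem_finset {a, b}
  obtain ⟨d, hd⟩ := Infinite.exists_notMem_finset {a, b, c}
  obtain ⟨e, he⟩ := Infinite.exists_notMem_finset {a, b, c, d}
  simp only [Finset.mem_insert, Finset.mem_singleton, not_or] at hc hd he
  refine ⟨![a, b, c, d, e], rfl, rfl, fun i j hij => ?_⟩
  fin_cases i <;> fin_cases j <;> simp_all

section Cones

variable {h v : ℤ → Vec 2} {s r : ℤ → ℝ}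

/-- The point of intersection of the planes with the normals `v i`, expressed by three successive
vectors `h j`. -/
def apex (h : ℤ → Vec 2) (s r : ℤ → ℝ) (j : ℤ) : Vec 2 :=
  r (j + 1) • (h j - s j • h (j + 1)) - r j • (h (j + 2) - s (j + 1) • h (j + 1))

namespace StripAngles

theorem one_sub_sq_ne_zero (hs : StripAngles v h s r) (j : ℤ) : 1 - s j ^ 2 ≠ 0 := by
  rw [← hs.sin_sq]
  exact pow_ne_zero 2 (hs.sin_ne_zero j)

theorem apex_orthogonal (hs : StripAngles v h s r) (i j : ℤ) : ⟪apex h s r j, v i⟫ = 0 := by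
  obtain ⟨w, h0, h1, -⟩ := hs.angle i j
  simp only [apex, map_sub, map_smul, LinearMap.sub_apply, LinearMap.smul_apply, smul_eq_mul]
  linear_combination r (j + 1) * h0 - r j * h1

theorem linearIndependent_apex (hs : StripAngles v h s r) (j : ℤ) :
    LinearIndependent ℝ ![h j, h (j + 1), apex h s r j] := by
  have general := hs.general_snd j (j + 1) (j + 2) (by simp) (by simp) (by simp)
  rw [linearIndependent_triple_iff] at general ⊢
  intro a b c e
  obtain ⟨ha, hb, hc⟩ := general (a + c * r (j + 1))
    (b - c * (r (j + 1) * s j - r j * s (j + 1))) (-(c * r j)) (by rw [← e, apex]; module)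
  obtain rfl : c = 0 := by simpa [hs.sin_ne_zero j] using hc
  exact ⟨by simpa using ha, by simpa using hb, rfl⟩

theorem apex_ne_zero (hs : StripAngles v h s r) (j : ℤ) : apex h s r j ≠ 0 :=
  (hs.linearIndependent_apex j).ne_zero 2

theorem apex_eq_smul (hs : StripAngles v h s r) (j : ℤ) :
    ∃ c : ℝ, apex h s r j = c • apex h s r 0 := by
  refine exists_eq_smul_of_orthogonal
    (hs.general_fst 0 1 2 (by decide) (by decide) (by decide)) (hs.apex_ne_zero 0) ?_ ?_ <;>
  simp [Fin.forall_fin_succ, lorentzForm_comm (v _), hs.apex_orthogonal]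

theorem ruledDual_succ (hs : StripAngles v h s r) (j : ℤ) {x : Vec 2}
    (hx : ⟪apex h s r j, x⟫ = 0) : ∃ c : ℝ,
    ruledDual (h (j + 1)) (h (j + 2)) (s (j + 1)) x =
      ruledDual (h j) (h (j + 1)) (s j) x + c • apex h s r j := by
  have h0 := hs.sin_ne_zero j
  have h1 := hs.sin_ne_zero (j + 1)
  rw [← ruledDual_swap (h := h (j + 1)), ruledDual_eq h1 (hs.sin_sq _),
    ruledDual_eq h0 (hs.sin_sq _)]
  simp only [apex, map_sub, map_smul, LinearMap.sub_apply, LinearMap.smul_apply, smul_eq_mul] at hx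
  set X := ⟪h j, x⟫ - s j * ⟪h (j + 1), x⟫
  set Z := ⟪h (j + 2), x⟫ - s (j + 1) * ⟪h (j + 1), x⟫
  have hZ : Z = r (j + 1) * X / r j := by
    field_simp
    linarith
  refine ⟨X / (r j ^ 2 * r (j + 1)), ?_⟩
  rw [hZ, apex]
  match_scalars <;> field_simp <;> ring

theorem ruledDual_sub (hs : StripAngles v h s r) {x : Vec 2} (hx : ⟪apex h s r 0, x⟫ = 0) (j : ℤ) :
    ∃ c : ℝ, ruledDual (h j) (h (j + 1)) (s j) x =
      ruledDual (h 0) (h 1) (s 0) x + c • apex h s r 0 := by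
  have step (j : ℤ) : ∃ c : ℝ, ruledDual (h (j + 1)) (h (j + 1 + 1)) (s (j + 1)) x =
      ruledDual (h j) (h (j + 1)) (s j) x + c • apex h s r 0 := by
    obtain ⟨t, ht⟩ := hs.apex_eq_smul j
    obtain ⟨c, hc⟩ := hs.ruledDual_succ j (x := x) (by simp [ht, hx])
    rw [ht, smul_smul] at hc
    exact ⟨c * t, by rw [add_assoc, one_add_one_eq_two, hc]⟩
  induction j using Int.induction_on with
  | zero => exact ⟨0, by simp⟩
  | succ k ih =>
    obtain ⟨c, hc⟩ := ih
    obtain ⟨d, hd⟩ := step k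
    exact ⟨c + d, by rw [hd, hc]; module⟩
  | pred k ih =>
    obtain ⟨c, hc⟩ := ih
    obtain ⟨d, hd⟩ := step (-(k : ℤ) - 1)
    rw [sub_add_cancel, hc] at hd
    exact ⟨c - d, by rw [sub_add_cancel, sub_smul, ← add_sub_assoc, hd]; module⟩

theorem lorentzForm_ruledDual_self (hs : StripAngles v h s r) (i : ℤ) :
    ⟪v i, ruledDual (h 0) (h 1) (s 0) (v i)⟫ = 0 := by
  obtain ⟨w, h0, -, hw⟩ := hs.angle i 0
  have sin_ne_zero := hs.sin_ne_zero 0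
  rw [zero_add] at h0 hw
  rw [ruledDual_eq sin_ne_zero (hs.sin_sq _), h0]
  rw [lorentzForm_comm]
  simp only [map_sub, map_smul, LinearMap.sub_apply, LinearMap.smul_apply, smul_eq_mul,
    hs.unit_fst, h0]
  field_simp
  linarith

theorem ruledDual_injective (hs : StripAngles v h s r) :
    Function.Injective (ruledDual (h 0) (h 1) (s 0)) :=
  Function.LeftInverse.injective (g := ruledOp (h 0) (h 1) (s 0)) fun _ =>
    ruledOp_ruledDual (hs.unit_snd 0) (hs.unit_snd 1) (hs.one_sub_sq_ne_zero 0) (hs.cos_ne 0)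

/-- Otherwise the conic of the points `v i` would be the whole polar plane of the apex. -/
theorem lorentzForm_ruledDual_ne_zero (hs : StripAngles v h s r) {a b : ℤ} (hab : a ≠ b) :
    ⟪v a, ruledDual (h 0) (h 1) (s 0) (v b)⟫ ≠ 0 := by
  intro conjugate
  obtain ⟨f, rfl, rfl, hf⟩ := exists_injective_fin_five hab
  have finrank_eq := finrank_orthogonal_span_range (a := ![apex h s r 0])
    (by simpa using hs.apex_ne_zero 0)
  have isotropic := isTotallyIsotropic_of_five_points two_ne_zero
    (F := (lorentzForm 2).compRight (ruledDual (h 0) (h 1) (s 0))) ruledDual_isSymm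
    finrank_eq (p := v ∘ f)
    (fun i => mem_orthogonal_span_range_iff.mpr (by simp [hs.apex_orthogonal]))
    (fun i => hs.lorentzForm_ruledDual_self _) (hs.general_fst.comp hf) conjugate
  have finrank_le := isotropic.two_mul_finrank_le hs.ruledDual_injective
  simp [finrank_eq] at finrank_le

theorem lorentzForm_apex_ruledOp_ne_zero (hs : StripAngles v h s r) :
    ⟪apex h s r 0, ruledOp (h 0) (h 1) (s 0) (apex h s r 0)⟫ ≠ 0 := by
  intro h0
  have dual_op := ruledDual_ruledOp (hs.unit_snd 0) (hs.unit_snd 1) (hs.one_sub_sq_ne_zero 0)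
    (hs.cos_ne 0) (x := apex h s r 0)
  obtain ⟨α, β, γ, e⟩ := exists_coeff_of_orthogonal
    (hs.general_fst 0 1 2 (by decide) (by decide) (by decide)) (hs.apex_ne_zero 0)
    (hs.apex_orthogonal 0 0) (hs.apex_orthogonal 1 0) (hs.apex_orthogonal 2 0) h0
  let F := (lorentzForm 2).compRight (ruledDual (h 0) (h 1) (s 0))
  have conjugate (i : ℤ) : F (α • v 0 + β • v 1 + γ • v 2) (v i) = 0 := by
    rw [e, LinearMap.BilinForm.compRight_apply, lorentzForm_ruledDual, dual_op,
      hs.apex_orthogonal]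
  have F_self (i : ℤ) : F (v i) (v i) = 0 := hs.lorentzForm_ruledDual_self i
  have F_ne_zero {a b : ℤ} (hab : a ≠ b) : F (v a) (v b) ≠ 0 :=
    hs.lorentzForm_ruledDual_ne_zero hab
  obtain ⟨rfl, rfl, rfl⟩ := coeff_eq_zero_of_orthogonal_isotropic_triple two_ne_zero
    ruledDual_isSymm (F_self 0) (F_self 1) (F_self 2) (F_ne_zero (by decide))
    (F_ne_zero (by decide)) (F_ne_zero (by decide)) (conjugate 0) (conjugate 1) (conjugate 2)
  apply hs.apex_ne_zero 0
  rw [← dual_op, ← e]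
  simp only [zero_smul, add_zero, map_zero]

end StripAngles

/-- The quadric `K` is a cone (possibly degenerate) that is tangent to all planes with normals
`v i`: each of them is the polar plane of one of its own points, the normalization of which is
adapted to `v i`. -/
structure IsTangentCone (K : Form 2) (v : ℤ → Vec 2) : Prop where
  symm : K.IsSymm
  exists_apex : ∃ k ≠ 0, ∀ x, K.toBilin' x k = 0
  exists_contact : ∀ i, ∃ p, (∀ x, K.toBilin' x p = ⟪x, v i⟫) ∧ ⟪p, v i⟫ = 0

namespace StripAngles

variable {K : Form 2}

theorem tangentCone_eq_ruledOp (hs : StripAngles v h s r) (j : ℤ) {x : Vec 2}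
    (hx : ⟪apex h s r 0, ruledOp (h j) (h (j + 1)) (s j) x⟫ = 0) :
    tangentCone (ruledOp (h 0) (h 1) (s 0)) (apex h s r 0) x =
      ruledOp (h j) (h (j + 1)) (s j) x := by
  obtain ⟨c, hc⟩ := hs.ruledDual_sub hx j
  rw [ruledDual_ruledOp (hs.unit_snd _) (hs.unit_snd _) (hs.one_sub_sq_ne_zero j)
    (hs.cos_ne j)] at hc
  have op_dual := ruledOp_ruledDual (hs.unit_snd 0) (hs.unit_snd 1) (hs.one_sub_sq_ne_zero 0)
    (hs.cos_ne 0) (x := ruledOp (h j) (h (j + 1)) (s j) x)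
  conv_lhs => rw [hc]
  rw [map_add, map_smul, tangentCone_apply_self hs.lorentzForm_apex_ruledOp_ne_zero, smul_zero,
    add_zero, tangentCone_apply_of_orthogonal (by rw [op_dual, hx]), op_dual]

theorem isTangentCone_fst (hs : StripAngles v h s r) (hK : K.IsSymm)
    (K_eq : ∀ x y, K.toBilin' x y =
      ⟪x, tangentCone (ruledOp (h 0) (h 1) (s 0)) (apex h s r 0) y⟫) : IsTangentCone K v where
  symm := hK
  exists_apex := ⟨apex h s r 0, hs.apex_ne_zero 0, fun x => by
    rw [K_eq, tangentCone_apply_self hs.lorentzForm_apex_ruledOp_ne_zero, map_zero]⟩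
  exists_contact i := by
    have op_dual := ruledOp_ruledDual (hs.unit_snd 0) (hs.unit_snd 1) (hs.one_sub_sq_ne_zero 0)
      (hs.cos_ne 0) (x := v i)
    refine ⟨ruledDual (h 0) (h 1) (s 0) (v i), fun x => ?_, ?_⟩
    · rw [K_eq, tangentCone_apply_of_orthogonal (by rw [op_dual, hs.apex_orthogonal]), op_dual]
    · rw [lorentzForm_comm, hs.lorentzForm_ruledDual_self]

theorem linearIndependent_ruledOp_apex (hs : StripAngles v h s r) (j : ℤ) : LinearIndependent ℝ
    ![h j, h (j + 1), ruledOp (h j) (h (j + 1)) (s j) (apex h s r 0)] := by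
  obtain ⟨t, ht⟩ := hs.apex_eq_smul j
  have independent := hs.linearIndependent_apex j
  apply linearIndependent_ruledOp
  rw [linearIndependent_triple_iff] at independent ⊢
  intro a b c e
  obtain ⟨-, -, rfl⟩ := independent (t * a) (t * b) c (by
    rw [ht]; linear_combination (norm := module) t • e)
  exact independent a b 0 (by rw [← e]; module)

theorem isTangentCone_snd (hs : StripAngles v h s r) (hK : K.IsSymm)
    (K_eq : ∀ x y, K.toBilin' x y =
      ⟪x, tangentCone (ruledOp (h 0) (h 1) (s 0)) (apex h s r 0) y⟫) :
    IsTangentCone (K - lorentz 2) h := by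
  have sub_eq (j : ℤ) {p : Vec 2} (hp : ⟪h j, p⟫ = 0)
      (hkp : ⟪ruledOp (h j) (h (j + 1)) (s j) (apex h s r 0), p⟫ = 0) (x : Vec 2) :
      (K - lorentz 2).toBilin' x p =
        (s j - ⟪h j, h (j + 1)⟫)⁻¹ * ⟪h (j + 1), p⟫ * ⟪x, h j⟫ := by
    rw [← lorentzForm_ruledOp] at hkp
    rw [map_sub, LinearMap.sub_apply, LinearMap.sub_apply, K_eq, hs.tangentCone_eq_ruledOp j hkp,
      ruledOp_apply, hp]
    simp [lorentzForm, mul_assoc]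
  refine ⟨hK.sub lorentz_isSymm, ?_, fun j => ?_⟩
  · have finrank_eq := finrank_orthogonal_span_range (hs.linearIndependent_ruledOp_apex 0)
    obtain ⟨⟨p, hp⟩, p_ne⟩ := Module.finrank_pos_iff_exists_ne_zero.mp
      (finrank_eq.trans_gt (by decide))
    rw [mem_orthogonal_span_range_iff] at hp
    refine ⟨p, by simpa using p_ne, fun x => ?_⟩
    have hp1 : ⟪h (0 + 1), p⟫ = 0 := hp 1
    rw [sub_eq 0 (hp 0) (hp 2), hp1, mul_zero, zero_mul]
  · obtain ⟨p, hp⟩ := exists_lorentzForm_eq (hs.linearIndependent_ruledOp_apex j)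
      ![0, s j - ⟪h j, h (j + 1)⟫, 0]
    have hp0 : ⟪h j, p⟫ = 0 := hp 0
    have hp1 : ⟪h (j + 1), p⟫ = s j - ⟪h j, h (j + 1)⟫ := hp 1
    refine ⟨p, fun x => ?_, by rw [lorentzForm_comm, hp0]⟩
    rw [sub_eq j hp0 (hp 2), hp1, inv_mul_cancel₀ (sub_ne_zero.mpr (hs.cos_ne j)), one_mul]

theorem exists_isTangentCone (hs : StripAngles v h s r) :
    ∃ K : Form 2, IsTangentCone K v ∧ IsTangentCone (K - lorentz 2) h := by
  let K : Form 2 := LinearMap.BilinForm.toMatrix'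
    ((lorentzForm 2).compRight (tangentCone (ruledOp (h 0) (h 1) (s 0)) (apex h s r 0)))
  have K_eq (x y : Vec 2) : K.toBilin' x y =
      ⟪x, tangentCone (ruledOp (h 0) (h 1) (s 0)) (apex h s r 0) y⟫ := by
    rw [Matrix.toBilin'_toMatrix', LinearMap.BilinForm.compRight_apply]
  have hK : K.IsSymm := Matrix.isSymm_toBilin'_iff_isSymm.mp ⟨fun x y => by
    simp only [K_eq]
    rw [lorentzForm_tangentCone fun _ _ => lorentzForm_ruledOp, lorentzForm_comm]⟩
  exact ⟨K, hs.isTangentCone_fst hK K_eq, hs.isTangentCone_snd hK K_eq⟩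

end StripAngles

end Cones

section Complexification

variable {n : ℕ}

/-- The inclusion of the real coordinate vectors into the complex ones. -/
noncomputable def toC : Vec n →ₗ[ℝ] CVec n := (Algebra.linearMap ℝ ℂ).compLeft (Fin (n + 2))

/-- The complex bilinear extension of the form with matrix `A`: the function `cbil A` as a bilinear
form. -/
noncomputable def complexForm (A : Form n) : LinearMap.BilinForm ℂ (CVec n) :=
  (A.map (fun r : ℝ => (r : ℂ))).toBilin'

theorem cbil_eq_complexForm (A : Form n) (x y : CVec n) : cbil A x y = complexForm A x y :=
  (Matrix.toBilin'_apply' _ _ _).symm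

theorem toC_apply (x : Vec n) (k : Fin (n + 2)) : toC x k = (x k : ℂ) := rfl

theorem toC_injective : Function.Injective (toC (n := n)) := fun _ _ h =>
  funext fun k => Complex.ofReal_injective (congrFun h k)

theorem toC_re_add_I_smul_toC_im (w : CVec n) :
    toC (fun k => (w k).re) + Complex.I • toC (fun k => (w k).im) = w := by
  ext k
  simp [toC_apply, mul_comm Complex.I]

theorem linearMap_ext_toC {f g : CVec n →ₗ[ℂ] ℂ} (h : ∀ x, f (toC x) = g (toC x)) : f = g := by
  refine LinearMap.ext fun w => ?_
  rw [← toC_re_add_I_smul_toC_im w, map_add, map_add, map_smul, map_smul, h, h]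

theorem complexForm_toC (A : Form n) (x y : Vec n) :
    complexForm A (toC x) (toC y) = (A.toBilin' x y : ℂ) := by
  simp [complexForm, Matrix.toBilin'_apply, toC_apply]

theorem complexForm_lorentz_toC (x y : Vec n) :
    complexForm (lorentz n) (toC x) (toC y) = (⟪x, y⟫ : ℂ) :=
  complexForm_toC _ x y

theorem complexForm_pencil (A B : Form n) (a b : ℝ) (x y : CVec n) :
    complexForm (a • A + b • B) x y = a * complexForm A x y + b * complexForm B x y := by
  simp only [complexForm, Matrix.toBilin'_apply, Matrix.map_apply, Matrix.add_apply,
    Matrix.smul_apply, smul_eq_mul, Finset.mul_sum, ← Finset.sum_add_distrib]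
  refine Finset.sum_congr rfl fun i _ => Finset.sum_congr rfl fun j _ => ?_
  push_cast
  ring

theorem complexForm_comm {A : Form n} (hA : A.IsSymm) (x y : CVec n) :
    complexForm A x y = complexForm A y x := by
  have isSymm : (complexForm A).IsSymm := Matrix.isSymm_toBilin'_iff_isSymm.mpr (hA.map _)
  exact isSymm.eq x y

theorem eq_zero_of_cpolar_lorentz_eq_zero {z : CVec n} (h : cpolar (lorentz n) z = 0) : z = 0 := by
  refine Matrix.eq_zero_of_mulVec_eq_zero ?_ h
  have det_eq := (Complex.ofRealHom.map_det (lorentz n)).symm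
  rw [det_lorentz] at det_eq
  exact det_eq.trans_ne (by simp)

theorem toC_mem_complexify {W : Submodule ℝ (Vec n)} {x : Vec n} (hx : x ∈ W) :
    toC x ∈ complexify W := Submodule.subset_span ⟨x, hx, rfl⟩

theorem complexify_span (s : Set (Vec n)) :
    complexify (Submodule.span ℝ s) = Submodule.span ℂ (toC '' s) := by
  rw [← Submodule.span_span_of_tower ℝ ℂ (toC '' s), ← Submodule.map_span, Submodule.map_coe]
  rfl

theorem exists_complex_coeff_of_mem {W : Submodule ℝ (Vec n)} (hW : Module.finrank ℝ W = 3)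
    {x y z : Vec n} (h : LinearIndependent ℝ ![x, y, z]) (hx : x ∈ W) (hy : y ∈ W) (hz : z ∈ W)
    {w : CVec n} (hw : w ∈ complexify W) :
    ∃ a b c : ℂ, a • toC x + b • toC y + c • toC z = w := by
  rw [← span_triple_eq_of_finrank_eq_three hW h hx hy hz, complexify_span] at hw
  simpa only [Set.image_insert_eq, Set.image_singleton, Submodule.mem_span_triple] using hw

theorem mem_complexify_iff {h : Vec n} {W : Submodule ℝ (Vec n)} (hW : IsUnitNormal h W)
    {w : CVec n} : w ∈ complexify W ↔ complexForm (lorentz n) w (toC h) = 0 := by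
  constructor
  · intro hw
    refine Submodule.span_le (p := LinearMap.ker ((complexForm (lorentz n)).flip (toC h))).mpr
      ?_ hw
    rintro _ ⟨x, hx, rfl⟩
    change complexForm _ (toC x) _ = 0
    rw [complexForm_lorentz_toC, lorentzForm_comm, (hW.mem_iff x).mp hx, Complex.ofReal_zero]
  · intro hw
    rw [← toC_re_add_I_smul_toC_im w] at hw ⊢
    rw [map_add, map_smul, LinearMap.add_apply, LinearMap.smul_apply, complexForm_lorentz_toC,
      complexForm_lorentz_toC, smul_eq_mul, mul_comm, Complex.ext_iff] at hw
    refine add_mem (toC_mem_complexify ?_) (Submodule.smul_mem _ _ (toC_mem_complexify ?_))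
    · rw [hW.mem_iff, lorentzForm_comm]
      simpa using hw.1
    · rw [hW.mem_iff, lorentzForm_comm]
      simpa using hw.2

end Complexification

section Tangency

theorem finrank_ker_lorentzForm {n : ℕ} {k : Vec n} (hk : k ≠ 0) :
    Module.finrank ℝ (LinearMap.ker (lorentzForm n k)) = n + 1 := by
  have functional_ne : lorentzForm n k ≠ 0 := fun h0 =>
    hk (eq_zero_of_forall_lorentzForm_eq_zero fun z => by rw [h0, LinearMap.zero_apply])
  have := Module.Dual.finrank_ker_add_one_of_ne_zero functional_ne
  rw [Module.finrank_fin_fun] at this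
  omega

theorem IsUnitNormal.finrank_eq {n : ℕ} {h : Vec n} {W : Submodule ℝ (Vec n)}
    (hW : IsUnitNormal h W) : Module.finrank ℝ W = n + 1 := by
  obtain rfl : W = LinearMap.ker (lorentzForm n h) := by
    ext w
    rw [hW.mem_iff, LinearMap.mem_ker]
  refine finrank_ker_lorentzForm ?_
  rintro rfl
  simpa using hW.unit

theorem linearIndependent_cpolar {n : ℕ} {A : Form n} {u z : CVec n} (hz : z ≠ 0)
    (hL : complexForm (lorentz n) u z = 0) (hA : complexForm A u z ≠ 0) :
    LinearIndependent ℂ ![cpolar (lorentz n) z, cpolar A z] := by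
  rw [LinearIndependent.pair_iff]
  intro x y e
  have pairing : x * complexForm (lorentz n) u z + y * complexForm A u z = 0 := by
    have := congrArg (dotProduct u) e
    rwa [dotProduct_add, dotProduct_smul, dotProduct_smul, dotProduct_zero, smul_eq_mul,
      smul_eq_mul, ← cbil, ← cbil, cbil_eq_complexForm, cbil_eq_complexForm] at this
  obtain rfl : y = 0 := by simpa [hL, hA] using pairing
  rw [zero_smul, add_zero, smul_eq_zero] at e
  exact ⟨e.resolve_right (mt eq_zero_of_cpolar_lorentz_eq_zero hz), rfl⟩

/-- The plane `W` with unit normal `v` is tangent to the quadratic cone `K` with apex `k` along the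
line spanned by `k` and `p`. The contact point `p` is determined up to multiples of `k` and is
normalised by `orthogonal`. -/
structure TouchesCone (K : Form 2) (k v p : Vec 2) (W : Submodule ℝ (Vec 2)) : Prop where
  symm : K.IsSymm
  apply_apex : ∀ x, K.toBilin' x k = 0
  eq_smul_apex : ∀ x, (∀ y, K.toBilin' y x = 0) → ∃ t : ℝ, x = t • k
  apex_not_null : ⟪k, k⟫ ≠ 0
  normal : IsUnitNormal v W
  apply_contact : ∀ x, K.toBilin' x p = ⟪x, v⟫
  contact_mem : p ∈ W
  orthogonal : ⟪k, p⟫ = 0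

namespace TouchesCone

variable {K : Form 2} {k v p q : Vec 2} {W : Submodule ℝ (Vec 2)}

theorem apply_comm (h : TouchesCone K k v p W) (x y : Vec 2) :
    K.toBilin' x y = K.toBilin' y x :=
  (Matrix.isSymm_toBilin'_iff_isSymm.mpr h.symm).eq x y

theorem apex_mem (h : TouchesCone K k v p W) : k ∈ W := by
  rw [h.normal.mem_iff, lorentzForm_comm, ← h.apply_contact, h.apply_comm, h.apply_apex]

theorem apply_contact_of_mem (h : TouchesCone K k v p W) (hq : q ∈ W) : K.toBilin' q p = 0 := by
  rw [h.apply_contact, lorentzForm_comm, (h.normal.mem_iff q).mp hq]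

theorem linearIndependent (h : TouchesCone K k v p W) : LinearIndependent ℂ ![toC k, toC p] := by
  rw [LinearIndependent.pair_iff]
  intro x y e
  have pairing := congrArg (complexForm K (toC v)) e
  simp only [map_add, map_smul, complexForm_toC, h.apply_apex, h.apply_contact, h.normal.unit,
    map_zero, smul_eq_mul, Complex.ofReal_zero, mul_zero, zero_add, Complex.ofReal_one,
    mul_one] at pairing
  have k_ne : toC k ≠ 0 := by
    rw [map_ne_zero_iff _ toC_injective]
    rintro rfl
    exact h.apex_not_null (by simp)
  exact ⟨by simpa [pairing, k_ne] using e, pairing⟩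

theorem exists_linearIndependent (h : TouchesCone K k v p W) :
    ∃ q ∈ W, LinearIndependent ℝ ![q, k, p] := by
  have not_le : ¬ W ≤ Submodule.span ℝ (Set.range ![k, p]) := fun hle => by
    have finrank_le := (Submodule.finrank_mono hle).trans (finrank_range_le_card ![k, p])
    simp [h.normal.finrank_eq] at finrank_le
  obtain ⟨q, hq, q_notMem⟩ := SetLike.not_le_iff_exists.mp not_le
  refine ⟨q, hq, linearIndependent_finCons.mpr ⟨?_, q_notMem⟩⟩
  rw [LinearIndependent.pair_iff]
  intro x y e
  have := LinearIndependent.pair_iff.mp h.linearIndependent x y (by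
    simpa using congrArg toC e)
  exact_mod_cast this

theorem apply_self_ne_zero (h : TouchesCone K k v p W) (hq : q ∈ W)
    (hi : LinearIndependent ℝ ![q, k, p]) : K.toBilin' q q ≠ 0 := by
  intro hqq
  have apply_mem {w : Vec 2} (hw : w ∈ W) : K.toBilin' w q = 0 := by
    obtain ⟨a, b, c, rfl⟩ :=
      exists_coeff_of_mem h.normal.finrank_eq hi hq h.apex_mem h.contact_mem hw
    simp only [map_add, map_smul, LinearMap.add_apply, LinearMap.smul_apply, hqq,
      h.apply_comm k, h.apply_comm p, h.apply_apex, h.apply_contact_of_mem hq, smul_zero, add_zero]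
  have polar_q (y : Vec 2) : K.toBilin' y q = ⟪y, v⟫ * K.toBilin' v q := by
    have mem : y - ⟪y, v⟫ • v ∈ W := by
      rw [h.normal.mem_iff, map_sub, map_smul, h.normal.unit, lorentzForm_comm]
      simp
    simpa [sub_eq_zero] using apply_mem mem
  obtain ⟨t, ht⟩ := h.eq_smul_apex (q - K.toBilin' v q • p) fun y => by
    rw [map_sub, map_smul, h.apply_contact, polar_q, smul_eq_mul, mul_comm, sub_self]
  have := (linearIndependent_triple_iff.mp hi 1 (-t) (-K.toBilin' v q) (by
    linear_combination (norm := module) ht)).1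
  exact one_ne_zero this

theorem complexForm_apex (h : TouchesCone K k v p W) (w : CVec 2) :
    complexForm K w (toC k) = 0 :=
  LinearMap.congr_fun (f := (complexForm K).flip (toC k)) (g := 0)
    (linearMap_ext_toC fun x => by simp [complexForm_toC, h.apply_apex]) w

theorem complexForm_contact (h : TouchesCone K k v p W) (w : CVec 2) :
    complexForm K w (toC p) = complexForm (lorentz 2) w (toC v) :=
  LinearMap.congr_fun (f := (complexForm K).flip (toC p))
    (g := (complexForm (lorentz 2)).flip (toC v))
    (linearMap_ext_toC fun x => by
      simp [complexForm_toC, h.apply_contact, lorentzForm]) w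

theorem complexForm_self (h : TouchesCone K k v p W) (hq : q ∈ W) (x y z : ℂ) :
    complexForm K (x • toC q + y • toC k + z • toC p) (x • toC q + y • toC k + z • toC p) =
      x ^ 2 * K.toBilin' q q := by
  simp only [map_add, map_smul, LinearMap.add_apply, LinearMap.smul_apply, complexForm_toC,
    h.apply_comm k, h.apply_comm p q, h.apply_apex, h.apply_contact_of_mem hq,
    h.apply_contact_of_mem h.contact_mem, Complex.ofReal_zero, smul_eq_mul]
  ring

theorem complexForm_lorentz_self (h : TouchesCone K k v p W) (x y : ℂ) :
    complexForm (lorentz 2) (x • toC k + y • toC p) (x • toC k + y • toC p) =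
      x ^ 2 * ⟪k, k⟫ + y ^ 2 * ⟪p, p⟫ := by
  simp only [map_add, map_smul, LinearMap.add_apply, LinearMap.smul_apply,
    complexForm_lorentz_toC, lorentzForm_comm p k, h.orthogonal, Complex.ofReal_zero, smul_eq_mul]
  ring

variable {D : DarbouxCyclide 2} {a b : ℝ}

theorem tangentAt (h : TouchesCone (a • lorentz 2 + b • D.form) k v p W) (hb : b ≠ 0) {z : CVec 2}
    (hz : z ≠ 0) (hzW : z ∈ complexify W) (hzz : complexForm (lorentz 2) z z = 0) {γ : ℂ}
    (hγ : γ ≠ 0) (polar : ∀ w, complexForm (a • lorentz 2 + b • D.form) w z =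
      γ * complexForm (lorentz 2) w (toC v)) : D.TangentAt W z := by
  have hbC : (b : ℂ) ≠ 0 := Complex.ofReal_ne_zero.mpr hb
  have form_eq (w : CVec 2) : complexForm D.form w z =
      (b : ℂ)⁻¹ * (γ * complexForm (lorentz 2) w (toC v) - a * complexForm (lorentz 2) w z) := by
    rw [← polar, complexForm_pencil]
    field_simp
    ring
  have hzv := (mem_complexify_iff h.normal).mp hzW
  refine ⟨⟨hz, ?_, ?_⟩, hzW, linearIndependent_cpolar hz (u := toC v) ?_ ?_, fun w => ?_⟩
  · rw [cbil_eq_complexForm, hzz]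
  · rw [cbil_eq_complexForm, form_eq, hzv, hzz]
    ring
  · rw [complexForm_comm lorentz_isSymm, hzv]
  · rw [form_eq, complexForm_lorentz_toC, h.normal.unit,
      complexForm_comm lorentz_isSymm (toC v), hzv]
    simp [hbC, hγ]
  · rw [mem_complexify_iff h.normal, cbil_eq_complexForm, cbil_eq_complexForm, form_eq, and_comm]
    refine and_congr_left fun hw => ?_
    simp [hw, hbC, hγ]

theorem tangentAt_add_smul (h : TouchesCone (a • lorentz 2 + b • D.form) k v p W) (hb : b ≠ 0)
    {κ : ℂ} (hκ : κ ^ 2 * ⟪p, p⟫ = -⟪k, k⟫) : D.TangentAt W (toC k + κ • toC p) := by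
  refine h.tangentAt hb (γ := κ) (fun h0 => ?_) ?_ ?_ ?_ fun w => ?_
  · have := LinearIndependent.pair_iff.mp h.linearIndependent 1 κ (by rw [one_smul, h0])
    exact one_ne_zero this.1
  · exact add_mem (toC_mem_complexify h.apex_mem)
      (Submodule.smul_mem _ _ (toC_mem_complexify h.contact_mem))
  · have := h.complexForm_lorentz_self 1 κ
    rw [one_smul, hκ] at this
    rw [this]
    ring
  · rintro rfl
    have := h.apex_not_null
    simp_all
  · rw [map_add, map_smul, h.complexForm_apex, h.complexForm_contact, zero_add, smul_eq_mul]

theorem tangentAtTwoPoints (h : TouchesCone (a • lorentz 2 + b • D.form) k v p W) (hb : b ≠ 0)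
    (hpp : ⟪p, p⟫ ≠ 0) : D.TangentAtTwoPoints W := by
  have hppC : (⟪p, p⟫ : ℂ) ≠ 0 := Complex.ofReal_ne_zero.mpr hpp
  obtain ⟨κ, hκ⟩ := IsAlgClosed.exists_pow_nat_eq (-(⟪k, k⟫ : ℂ) / ⟪p, p⟫) two_pos
  rw [eq_div_iff hppC] at hκ
  have κ_ne : κ ≠ 0 := by
    rintro rfl
    have := h.apex_not_null
    simp_all
  refine ⟨toC k + κ • toC p, toC k + (-κ) • toC p, ?_, h.tangentAt_add_smul hb hκ,
    h.tangentAt_add_smul hb (by rw [neg_sq, hκ]), fun w hw hD => ?_⟩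
  · have := (LinearIndependent.pair_add_smul_add_smul_iff (a := 1) (b := κ) (c := 1)
      (d := -κ)).mpr ⟨h.linearIndependent, by simpa using neg_ne_self.mpr κ_ne⟩
    simpa only [one_smul] using this
  obtain ⟨q, hq, hi⟩ := h.exists_linearIndependent
  obtain ⟨x, y, z, rfl⟩ :=
    exists_complex_coeff_of_mem h.normal.finrank_eq hi hq h.apex_mem h.contact_mem hw
  obtain ⟨-, hL, hF⟩ := hD
  rw [cbil_eq_complexForm] at hL hF
  have hK := complexForm_pencil (lorentz 2) D.form a b (x • toC q + y • toC k + z • toC p)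
    (x • toC q + y • toC k + z • toC p)
  rw [hL, hF, h.complexForm_self hq, mul_zero, mul_zero, add_zero, mul_eq_zero, pow_eq_zero_iff
    two_ne_zero, Complex.ofReal_eq_zero, or_iff_left (h.apply_self_ne_zero hq hi)] at hK
  obtain rfl := hK
  rw [zero_smul, zero_add] at hL ⊢
  rw [h.complexForm_lorentz_self] at hL
  have factored : (z - y * κ) * (z + y * κ) = 0 := mul_left_cancel₀ hppC (by
    linear_combination hL - y ^ 2 * hκ)
  rw [Submodule.mem_span_singleton, Submodule.mem_span_singleton]
  rcases mul_eq_zero.mp factored with e | e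
  · exact Or.inl ⟨y, by rw [sub_eq_zero.mp e]; module⟩
  · exact Or.inr ⟨y, by rw [eq_neg_of_add_eq_zero_left e]; module⟩

theorem lorentzForm_contact_ne_zero (h : TouchesCone K k v p W) (hpp : ⟪p, p⟫ = 0) (hq : q ∈ W)
    (hi : LinearIndependent ℝ ![q, k, p]) : ⟪q, p⟫ ≠ 0 := by
  intro hqp
  have hvp := (h.normal.mem_iff p).mp h.contact_mem
  have orthogonal_mem {w : Vec 2} (hw : w ∈ W) : ⟪w, p⟫ = 0 := by
    obtain ⟨x, y, z, rfl⟩ :=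
      exists_coeff_of_mem h.normal.finrank_eq hi hq h.apex_mem h.contact_mem hw
    simp [hqp, h.orthogonal, hpp]
  have p_eq : p = 0 := eq_zero_of_forall_lorentzForm_eq_zero fun y => by
    have mem : y - ⟪v, y⟫ • v ∈ W := by
      rw [h.normal.mem_iff, map_sub, map_smul, h.normal.unit]
      simp
    have := orthogonal_mem mem
    rwa [map_sub, map_smul, LinearMap.sub_apply, LinearMap.smul_apply, hvp, smul_zero, sub_zero,
      lorentzForm_comm] at this
  exact hi.ne_zero 2 p_eq

theorem tangentAtDoublePoint (h : TouchesCone (a • lorentz 2 + b • D.form) k v p W) (hb : b ≠ 0)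
    (hpp : ⟪p, p⟫ = 0) : D.TangentAtDoublePoint W := by
  obtain ⟨q, hq, hi⟩ := h.exists_linearIndependent
  have hbC : (b : ℂ) ≠ 0 := Complex.ofReal_ne_zero.mpr hb
  have hqp : (⟪q, p⟫ : ℂ) ≠ 0 :=
    Complex.ofReal_ne_zero.mpr (h.lorentzForm_contact_ne_zero hpp hq hi)
  have hqq := Complex.ofReal_ne_zero.mpr (h.apply_self_ne_zero hq hi)
  refine ⟨toC p, ?_, -a / b, ((a • lorentz 2 + b • D.form).toBilin' q q : ℂ) / (b * ⟪q, p⟫ ^ 2),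
    div_ne_zero hqq (mul_ne_zero hbC (pow_ne_zero 2 hqp)), fun w hw => ?_⟩
  · refine h.tangentAt hb ?_ (toC_mem_complexify h.contact_mem) ?_ one_ne_zero fun w => ?_
    · exact (map_ne_zero_iff _ toC_injective).mpr (hi.ne_zero 2)
    · rw [complexForm_lorentz_toC, hpp, Complex.ofReal_zero]
    · rw [h.complexForm_contact, one_mul]
  · obtain ⟨x, y, z, rfl⟩ :=
      exists_complex_coeff_of_mem h.normal.finrank_eq hi hq h.apex_mem h.contact_mem hw
    have hL : complexForm (lorentz 2) (x • toC q + y • toC k + z • toC p) (toC p) =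
        x * ⟪q, p⟫ := by
      simp [complexForm_lorentz_toC, h.orthogonal, hpp]
    have hK := complexForm_pencil (lorentz 2) D.form a b (x • toC q + y • toC k + z • toC p)
      (x • toC q + y • toC k + z • toC p)
    rw [h.complexForm_self hq] at hK
    rw [cbil_eq_complexForm, cbil_eq_complexForm, cbil_eq_complexForm, hL]
    field_simp
    linear_combination -hK

end TouchesCone

end Tangency

section Families

namespace TouchesCone

variable {K : Form 2} {k v v' p p' : Vec 2} {W W' : Submodule ℝ (Vec 2)}

theorem apex_ne_zero (h : TouchesCone K k v p W) : k ≠ 0 := by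
  rintro rfl
  exact h.apex_not_null (by simp)

theorem contact_ne_zero (h : TouchesCone K k v p W) : p ≠ 0 := by
  rintro rfl
  simpa [h.normal.unit] using h.apply_contact v

theorem eq_of_null_of_orthogonal (h : TouchesCone K k v p W) (h' : TouchesCone K k v' p' W')
    (hp : ⟪p, p⟫ = 0) (hp' : ⟪p', p'⟫ = 0) (hpp' : ⟪p, p'⟫ = 0) : W = W' := by
  have proportional := last_smul_eq_of_null_of_orthogonal hp hp' hpp'
  have l_ne := last_ne_zero_of_null hp h.contact_ne_zero
  have l_ne' := last_ne_zero_of_null hp' h'.contact_ne_zero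
  ext w
  have polar := congrArg (K.toBilin' w) proportional
  rw [map_smul, map_smul, h.apply_contact, h'.apply_contact, smul_eq_mul, smul_eq_mul] at polar
  rw [h.normal.mem_iff, h'.normal.mem_iff, lorentzForm_comm v, lorentzForm_comm v',
    ← mul_right_inj' l_ne', polar, mul_zero, mul_eq_zero, or_iff_right l_ne]

/-- The null contact points lie on two conics in the polar plane of the apex. -/
theorem not_injective_of_null {v p : Fin 5 → Vec 2} {W : Fin 5 → Submodule ℝ (Vec 2)}
    (h : ∀ i, TouchesCone K k (v i) (p i) (W i)) (hp : ∀ i, ⟪p i, p i⟫ = 0) :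
    ¬ Function.Injective W := by
  intro hW
  have hpp {i j : Fin 5} (hij : i ≠ j) : ⟪p i, p j⟫ ≠ 0 := fun h0 =>
    hij (hW ((h i).eq_of_null_of_orthogonal (h j) (hp i) (hp j) h0))
  have general : InGeneralPosition ℝ p := fun i j l hij hjl hil =>
    linearIndependent_of_isotropic_triple two_ne_zero lorentzForm_isSymm (hp i) (hp j) (hp l)
      (hpp hij) (hpp hil) (hpp hjl)
  let P := LinearMap.ker (lorentzForm 2 k)
  let ρ := K.toBilin' (p 0) (p 1) / ⟪p 0, p 1⟫
  let F : LinearMap.BilinForm ℝ (Vec 2) := K.toBilin' - ρ • lorentzForm 2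
  have hF : F.IsSymm := ⟨fun x y => by
    simp only [F, LinearMap.sub_apply, LinearMap.smul_apply, (h 0).apply_comm x,
      lorentzForm_comm x]⟩
  have isotropic : IsTotallyIsotropic F P := by
    refine isTotallyIsotropic_of_five_points two_ne_zero hF
      (finrank_ker_lorentzForm (h 0).apex_ne_zero)
      (fun i => LinearMap.mem_ker.mpr (h i).orthogonal) (fun i => ?_) general ?_
    · simp [F, hp, (h i).apply_contact_of_mem (h i).contact_mem]
    · simp [F, ρ, hpp (show (0 : Fin 5) ≠ 1 by decide)]
  have v_mem : v 0 ∈ P := LinearMap.mem_ker.mpr (by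
    rw [← (h 0).apply_contact, (h 0).apply_comm, (h 0).apply_apex])
  have := isotropic (v 0) v_mem (p 0) (LinearMap.mem_ker.mpr (h 0).orthogonal)
  simp [F, (h 0).apply_contact, (h 0).normal.unit,
    ((h 0).normal.mem_iff _).mp (h 0).contact_mem] at this

theorem encard_le_four {S : Set (Submodule ℝ (Vec 2))}
    (hS : ∀ W ∈ S, ∃ v p, TouchesCone K k v p W ∧ ⟪p, p⟫ = 0) : S.encard ≤ 4 := by
  by_contra! hlt
  obtain ⟨T, hTS, hT⟩ := Set.exists_subset_encard_eq (s := S) (k := 5) (Order.add_one_le_of_lt hlt)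
  have := (Set.finite_of_encard_eq_coe hT).to_subtype
  let e : Fin 5 ≃ T := (Finite.equivFinOfCardEq (by
    rw [Nat.card_coe_set_eq, Set.ncard, hT]; rfl)).symm
  choose v p h hp using fun i => hS _ (hTS (e i).2)
  exact not_injective_of_null h hp (Subtype.val_injective.comp e.injective)

theorem rank_eq_three (h : TouchesCone K k v p W) : K.rank = 3 := by
  have ker_eq : LinearMap.ker K.mulVecLin = Submodule.span ℝ {k} := by
    ext x
    have mulVec_eq_zero : K.mulVec x = 0 ↔ ∀ y, K.toBilin' y x = 0 := by
      simp only [← dotProduct_eq_zero_iff, Matrix.toBilin'_apply']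
      exact forall_congr' fun y => by rw [dotProduct_comm]
    rw [LinearMap.mem_ker, Matrix.mulVecLin_apply, mulVec_eq_zero, Submodule.mem_span_singleton]
    refine ⟨fun hx => (h.eq_smul_apex x hx).imp fun _ => Eq.symm, ?_⟩
    rintro ⟨t, rfl⟩ y
    rw [map_smul, h.apply_apex, smul_zero]
  have := K.mulVecLin.finrank_range_add_finrank_ker
  rw [ker_eq, finrank_span_singleton h.apex_ne_zero, Module.finrank_fin_fun] at this
  rw [Matrix.rank]
  omega

theorem isTangentPlane (h : TouchesCone K k v p W) : IsTangentPlane K W := by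
  refine ⟨p, fun h0 => ?_, ?_, fun w => ?_⟩
  · have := h.apply_contact v
    rw [h.normal.unit, ← bil_eq_toBilin', bil, h0, dotProduct_zero] at this
    exact zero_ne_one this
  · rw [bil_eq_toBilin', h.apply_contact_of_mem h.contact_mem]
  · rw [bil_eq_toBilin', h.apply_contact, h.normal.mem_iff, lorentzForm_comm]

end TouchesCone

variable {v : ℤ → Vec 2} {W : ℤ → Submodule ℝ (Vec 2)}

theorem GeneralPosition.not_null_of_forall_mem (hW : GeneralPosition W) {k : Vec 2} (hk : k ≠ 0)
    (mem : ∀ i, k ∈ W i) : ⟪k, k⟫ ≠ 0 := by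
  intro h0
  refine hW.no_common_point ⟨Projectivization.mk ℝ k hk, fun i => ⟨fun x hx => ?_, ?_⟩⟩
  · rw [Projectivization.submodule_mk] at hx
    obtain ⟨t, rfl⟩ := Submodule.mem_span_singleton.mp hx
    simp [bil_lorentz, h0]
  · rw [Projectivization.submodule_mk, Submodule.span_singleton_le_iff_mem]
    exact mem i

namespace IsTangentCone

theorem exists_touchesCone {K : Form 2} (hK : IsTangentCone K v)
    (hv : ∀ i, IsUnitNormal (v i) (W i)) (hW : GeneralPosition W) :
    ∃ k, ∀ i, ∃ p, TouchesCone K k (v i) p (W i) := by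
  obtain ⟨k, k_ne, apply_apex⟩ := hK.exists_apex
  have apply_comm := (Matrix.isSymm_toBilin'_iff_isSymm.mpr hK.symm).eq
  have radical_orthogonal {x : Vec 2} (hx : ∀ y, K.toBilin' y x = 0) (i : ℤ) :
      ⟪v i, x⟫ = 0 := by
    obtain ⟨p, hp, -⟩ := hK.exists_contact i
    rw [lorentzForm_comm, ← hp, apply_comm, hx]
  have apex_not_null := hW.not_null_of_forall_mem k_ne fun i =>
    ((hv i).mem_iff k).mpr (radical_orthogonal apply_apex i)
  refine ⟨k, fun i => ?_⟩
  obtain ⟨p, hp, hpv⟩ := hK.exists_contact i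
  refine ⟨p - (⟪k, p⟫ / ⟪k, k⟫) • k, hK.symm, apply_apex, fun x hx => ?_, apex_not_null, hv i,
    fun x => ?_, ?_, ?_⟩
  · exact exists_eq_smul_of_orthogonal
      (hW.inGeneralPosition hv 0 1 2 (by decide) (by decide) (by decide)) k_ne
      (by simp [Fin.forall_fin_succ, radical_orthogonal apply_apex])
      (by simp [Fin.forall_fin_succ, radical_orthogonal hx])
  · rw [map_sub, map_smul, apply_apex, smul_zero, sub_zero, hp]
  · rw [(hv i).mem_iff, map_sub, map_smul, radical_orthogonal apply_apex, smul_zero, sub_zero,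
      lorentzForm_comm, hpv]
  · rw [map_sub, map_smul, smul_eq_mul, div_mul_cancel₀ _ apex_not_null, sub_self]

variable {D : DarbouxCyclide 2} {a b : ℝ}

theorem envelop_and_twiceTangent (hK : IsTangentCone (a • lorentz 2 + b • D.form) v) (hb : b ≠ 0)
    (hv : ∀ i, IsUnitNormal (v i) (W i)) (hW : GeneralPosition W) :
    Envelop W D ∧ (∀ i, D.TwiceTangent (W i)) ∧
      {U | U ∈ Set.range W ∧ ¬ D.TangentAtTwoPoints U}.encard ≤ 4 := by
  obtain ⟨k, touches⟩ := hK.exists_touchesCone hv hW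
  choose p h using touches
  refine ⟨⟨a, b, hb, (h 0).rank_eq_three, fun i => (h i).isTangentPlane⟩, fun i => ?_,
    TouchesCone.encard_le_four (K := a • lorentz 2 + b • D.form) (k := k) ?_⟩
  · by_cases hpp : ⟪p i, p i⟫ = 0
    · exact Or.inr ((h i).tangentAtDoublePoint hb hpp)
    · exact Or.inl ((h i).tangentAtTwoPoints hb hpp)
  · rintro _ ⟨⟨i, rfl⟩, not_two⟩
    exact ⟨v i, p i, h i, not_imp_comm.mp ((h i).tangentAtTwoPoints hb) not_two⟩

theorem ne_smul_lorentz {K : Form 2} (hK : IsTangentCone K v) (hv : ⟪v 0, v 0⟫ ≠ 0) (c : ℝ) :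
    K ≠ c • lorentz 2 := by
  rintro rfl
  obtain ⟨k, k_ne, apply_apex⟩ := hK.exists_apex
  obtain ⟨p, hp, -⟩ := hK.exists_contact 0
  have toBilin'_eq (x y : Vec 2) : (c • lorentz 2).toBilin' x y = c * ⟪x, y⟫ := by
    simp [lorentzForm]
  have c_ne : c ≠ 0 := by
    rintro rfl
    refine hv ?_
    rw [← hp, toBilin'_eq, zero_mul]
  refine k_ne (eq_zero_of_forall_lorentzForm_eq_zero fun x => ?_)
  have := apply_apex x
  rwa [toBilin'_eq, mul_eq_zero, or_iff_right c_ne, lorentzForm_comm] at this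

end IsTangentCone

theorem exists_cyclic_envelop {M : ℤ → ℤ → RP 2} {V H : ℤ → Submodule ℝ (Vec 2)}
    (hM : IsCircularNet M) (hc : HasCircularLines M V H)
    (edges : ∀ j, ⨅ i, (M i j).submodule ⊔ (M i (j + 1)).submodule = ⊥)
    (hV : GeneralPosition V) (hH : GeneralPosition H) :
    ∃ D : DarbouxCyclide 2, Envelop V D ∧ Envelop H D ∧
      (∀ i, D.TwiceTangent (V i)) ∧ (∀ j, D.TwiceTangent (H j)) ∧
      {W | W ∈ Set.range V ∧ ¬ D.TangentAtTwoPoints W}.encard ≤ 4 ∧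
      {W | W ∈ Set.range H ∧ ¬ D.TangentAtTwoPoints W}.encard ≤ 4 := by
  have hm := hM.nullNet
  have mem_V (i j) : (M i j).rep ∈ V i := (mem_sphere_iff.mp (hc.mem_V i j)).2
  have mem_H (i j) : (M i j).rep ∈ H j := (mem_sphere_iff.mp (hc.mem_H i j)).2
  choose v hv using fun i => exists_isUnitNormal (hc.finrank_V i) (mem_V i 0) (mem_V i (0 + 1))
    (hm.null i 0) (hm.snd i 0)
  choose h hh using fun j => exists_isUnitNormal (hc.finrank_H j) (mem_H 0 j) (mem_H (0 + 1) j)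
    (hm.null 0 j) (hm.fst 0 j)
  have net : CircleNet (fun i j => (M i j).rep) v h :=
    { hm with
      unit_fst := fun i => (hv i).unit
      unit_snd := fun j => (hh j).unit
      orthogonal_fst := fun i j => ((hv i).mem_iff _).mp (mem_V i j)
      orthogonal_snd := fun i j => ((hh j).mem_iff _).mp (mem_H i j)
      general_fst := hV.inGeneralPosition hv
      general_snd := hH.inGeneralPosition hh }
  have strip := net.stripAngles fun j x hx => by
    rw [← Submodule.mem_bot ℝ, ← edges j, Submodule.mem_iInf]
    intro i
    rw [Projectivization.submodule_eq, Projectivization.submodule_eq, ← Submodule.span_insert]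
    exact hx i
  obtain ⟨K, hKv, hKh⟩ := strip.exists_isTangentCone
  let D : DarbouxCyclide 2 := ⟨K, hKv.symm, hKv.ne_smul_lorentz (by simp [(hv 0).unit])⟩
  have pencil_fst : (0 : ℝ) • lorentz 2 + (1 : ℝ) • D.form = K := by simp [D]
  have pencil_snd : (-1 : ℝ) • lorentz 2 + (1 : ℝ) • D.form = K - lorentz 2 := by
    simp [D, neg_add_eq_sub]
  obtain ⟨envelop_V, tangent_V, encard_V⟩ :=
    (pencil_fst ▸ hKv).envelop_and_twiceTangent one_ne_zero hv hV
  obtain ⟨envelop_H, tangent_H, encard_H⟩ :=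
    (pencil_snd ▸ hKh).envelop_and_twiceTangent one_ne_zero hh hH
  exact ⟨D, envelop_V, envelop_H, tangent_V, tangent_H, encard_V, encard_H⟩

end Families

theorem EdgesNotConcurrent.iInf_eq_bot {n : ℕ} {M : ℤ → ℤ → RP n} (h : EdgesNotConcurrent M)
    (j : ℤ) : ⨅ i, (M i j).submodule ⊔ (M i (j + 1)).submodule = ⊥ :=
  eq_bot_iff.mpr (h.fst 0 j ▸ le_inf (le_inf (iInf_le _ _) (iInf_le _ _)) (iInf_le _ _))

end CircularNets

theorem mainTheorem8_general :
    (∀ n, 3 ≤ n → ∀ (M : ℤ → ℤ → CircularNets.RP n) (V H : ℤ → Submodule ℝ (CircularNets.Vec n)),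
      CircularNets.IsCircularNet M → CircularNets.HasCircularLines M V H →
      ∃ D : CircularNets.DarbouxCyclide n,
        (∀ i, CircularNets.sphere (V i) ⊆ D.points) ∧
        (∀ j, CircularNets.sphere (H j) ⊆ D.points)) ∧
    (∀ (M : ℤ → ℤ → CircularNets.RP 2) (V H : ℤ → Submodule ℝ (CircularNets.Vec 2)),
      CircularNets.IsCircularNet M → CircularNets.HasCircularLines M V H →
      (∀ j, ⨅ i, (M i j).submodule ⊔ (M i (j + 1)).submodule = ⊥) →
      CircularNets.GeneralPosition V → CircularNets.GeneralPosition H →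
      ∃ D : CircularNets.DarbouxCyclide 2,
        CircularNets.Envelop V D ∧ CircularNets.Envelop H D ∧
        (∀ i, D.TwiceTangent (V i)) ∧ (∀ j, D.TwiceTangent (H j)) ∧
        {W | W ∈ Set.range V ∧ ¬ D.TangentAtTwoPoints W}.encard ≤ 4 ∧
        {W | W ∈ Set.range H ∧ ¬ D.TangentAtTwoPoints W}.encard ≤ 4) :=
  ⟨fun _ hn _ _ _ hM hc => CircularNets.exists_darbouxCyclide_sphere_subset hn hM hc,
    fun _ _ _ hM hc edges hV hH => CircularNets.exists_cyclic_envelop hM hc edges hV hH⟩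

theorem mainTheorem8 :
    (∀ (M : ℤ → ℤ → CircularNets.RP 3) (V H : ℤ → Submodule ℝ (CircularNets.Vec 3)),
      CircularNets.IsCircularNet M → CircularNets.HasCircularLines M V H →
      (∀ i, V i ≠ V (i + 1)) → (∀ j, H j ≠ H (j + 1)) →
      ∃ D : CircularNets.DarbouxCyclide 3,
        (∀ i, CircularNets.sphere (V i) ⊆ D.points) ∧
        (∀ j, CircularNets.sphere (H j) ⊆ D.points)) ∧
    (∀ (M : ℤ → ℤ → CircularNets.RP 2) (V H : ℤ → Submodule ℝ (CircularNets.Vec 2)),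
      CircularNets.IsCircularNet M → CircularNets.HasCircularLines M V H →
      CircularNets.EdgesNotConcurrent M →
      CircularNets.GeneralPosition V → CircularNets.GeneralPosition H →
      ∃ D : CircularNets.DarbouxCyclide 2,
        CircularNets.Envelop V D ∧ CircularNets.Envelop H D ∧
        (∀ i, D.TwiceTangent (V i)) ∧ (∀ j, D.TwiceTangent (H j)) ∧
        {W | W ∈ Set.range V ∧ ¬ D.TangentAtTwoPoints W}.encard ≤ 4 ∧
        {W | W ∈ Set.range H ∧ ¬ D.TangentAtTwoPoints W}.encard ≤ 4) := by
  exact ⟨fun M V H hM hc _ _ => mainTheorem8_general.1 3 le_rfl M V H hM hc,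
    fun M V H hM hc he => mainTheorem8_general.2 M V H hM hc he.iInf_eq_bot⟩
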